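/- Let $\Bbbk$ be a field and let $G$ be a finite abelian group, endowed with an arbitrary total order. A $G$-composition of $n$ is a sequence $\mathbf c^{\mathbf g}=(c_1^{g_1},\dots,c_k^{g_k})$ with $c_i\ge 1$ integers of sum $n$ and $g_i\in G$. Put $t_i=c_1+\cdots+c_i$ and let $(h_1,\dots,h_n)$ be the colour sequence in which $g_1$ is repeated $c_1$ times, then $g_2$ is repeated $c_2$ times, and so on. Let $\mathcal A=\{a_1<a_2<\cdots\}$ be a countable alphabet and let $F_{\mathbf c^{\mathbf g}}=\sum b_1^{h_1}b_2^{h_2}\cdots b_n^{h_n}$, a formal power series in the commuting variables $a^g$ ($a\in\mathcal A$, $g\in G$), where the sum runs over all $b_1\le\cdots\le b_n$ in $\mathcal A$ such that $b_{t_i}<b_{t_i+1}$ whenever $1\le i<k$ and $g_i\ge g_{i+1}$. Let $\mathrm{QSym}(G)$ be the span of all the $F_{\mathbf c^{\mathbf g}}$. Let $\Bbbk[G]$ be the algebra of $\Bbbk$-valued functions on $G$ under pointwise operations; $g\in G$ stands for its indicator function, so that $g\cdot h=\delta_{g,h}\,g$ and $1=\sum_{g\in G} g$. A combinatorial $G$-coloured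 Hopf algebra is a pair $(\mathcal H,\zeta)$ where $\mathcal H=\bigoplus_{n\ge0}\mathcal H_n$ is a connected ($\mathcal H_0=\Bbbk 1$) graded Hopf algebra over $\Bbbk$ and $\zeta\colon\mathcal H\to\Bbbk[G]$ is a morphism of algebras; a morphism $(\mathcal H,\zeta)\to(\mathcal H',\zeta')$ is a graded morphism of Hopf algebras $\Psi\colon\mathcal H\to\mathcal H'$ with $\zeta'\circ\Psi=\zeta$. Theorem. $\mathrm{QSym}(G)$ is a subalgebra of the algebra of formal power series. It is a connected graded Hopf algebra, with $F_{\mathbf c^{\mathbf g}}$ homogeneous of degree $n$ for each $G$-composition $\mathbf c^{\mathbf g}$ of $n$, and with coproduct $\Delta F_{\mathbf c^{\mathbf g}}=\sum_{i=0}^{n}F_{(\mathbf c^{\mathbf g})_{\le i}}\otimes F_{(\mathbf c^{\mathbf g})_{>i}}$, where $(\mathbf c^{\mathbf g})_{\le i}$ and $(\mathbf c^{\mathbf g})_{>i}$ are the two $G$-compositions, of $i$ and of $n-i$, into which $\mathbf c^{\mathbf g}$ is cut after its first $i$ units (a part that is cut in two keeps its colour on both sides). The linear map $\zeta_{\mathcal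 Q}^G\colon\mathrm{QSym}(G)\to\Bbbk[G]$ given by $\zeta_{\mathcal Q}^G(F_{(n)^g})=g$ for $n\ge1$ and $g\in G$, $\zeta_{\mathcal Q}^G(F_{()})=1$, and $\zeta_{\mathcal Q}^G(F_{\mathbf c^{\mathbf g}})=0$ if $\mathbf c$ has at least two parts, is a morphism of algebras. The pair $(\mathrm{QSym}(G),\zeta_{\mathcal Q}^G)$ is the terminal object in the category of combinatorial $G$-coloured Hopf algebras: for every combinatorial $G$-coloured Hopf algebra $(\mathcal H,\zeta)$ there is exactly one morphism $(\mathcal H,\zeta)\to(\mathrm{QSym}(G),\zeta_{\mathcal Q}^G)$. -/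

import Mathlib

open scoped TensorProduct

universe u v w w₁ w₂ w₃

/-! ### `G`-compositions and coloured quasi-symmetric functions -/

/-- A `G`-composition `(c₁^{g₁}, …, c_k^{g_k})`: a finite sequence of positive integers,
each of them carrying a colour in `G`. -/
abbrev GComposition (G : Type v) : Type v := List (ℕ+ × G)

namespace GComposition

variable {G : Type v}

/-- The size `‖c‖ = c₁ + ⋯ + c_k`. -/
def size (c : GComposition G) : ℕ := (c.map fun p => (p.1 : ℕ)).sum

/-- The sequence of colours `(h₁, …, h_n)`: `g₁` repeated `c₁` times, then `g₂` repeated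
`c₂` times, and so on. -/
def colourWord (c : GComposition G) : List G := c.flatMap fun p => List.replicate p.1 p.2

/-- The `G`-composition of `i` formed by the first `i` units of `c` (all of `c` if
`‖c‖ ≤ i`); a part that straddles the cut is shortened and keeps its colour. -/
def initialPart : GComposition G → ℕ → GComposition G
  | [], _ => []
  | (m, g) :: c, i =>
    if (m : ℕ) ≤ i then (m, g) :: initialPart c (i - m)
    else if h : 0 < i then [(⟨i, h⟩, g)] else []

/-- The `G`-composition that remains of `c` when its first `i` units are removed. -/
def finalPart : GComposition G → ℕ → GComposition G
  | [], _ => []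
  | (m, g) :: c, i =>
    if h : i < (m : ℕ) then (⟨m - i, Nat.sub_pos_of_lt h⟩, g) :: c else finalPart c (i - m)

/-- Membership in `Z_d`, for a `G`-composition `d = (d₁^{g₁}, …, d_k^{g_k})` of `n`: the
`n`-tuples `z_p = a_p^{h_p}` of coloured letters with `a₁ ≤ ⋯ ≤ a_n` such that
`a_{t_j} < a_{t_j + 1}`, where `t_j = d₁ + ⋯ + d_j`, as soon as `g_j ≥ g_{j+1}`.
(Positions in `Fin n` start at `0`, so the letter of index `t_j + 1` stands at position `t_j`;
the list index `j` starts at `0` as well.) -/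
def IsAdmissible [LinearOrder G] (d : GComposition G) (z : Fin d.size → ℕ × G) : Prop :=
  (∀ p : Fin d.size, d.colourWord[(p : ℕ)]? = some (z p).2) ∧
  Monotone (fun p => (z p).1) ∧
  ∀ (j : ℕ) (hj : j + 1 < d.length) (p q : Fin d.size),
    (q : ℕ) = size (d.take (j + 1)) → (p : ℕ) + 1 = q → d[j].2 ≥ d[j + 1].2 →
      (z p).1 < (z q).1

end GComposition

noncomputable section

/-- The formal power series `F_c = ∑_{(z₁, …, z_n) ∈ Z_c} z₁ ⋯ z_n` in the commuting variables
`a^g`, `(a, g) ∈ ℕ × G`: its coefficient at a monomial is the (finite) number of elements of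
`Z_c` whose product is that monomial. -/
def fundamentalF (k : Type u) [Field k] {G : Type v} [LinearOrder G] (c : GComposition G) :
    MvPowerSeries (ℕ × G) k :=
  fun e => (Nat.card {z : Fin c.size → ℕ × G //
    c.IsAdmissible z ∧ ∑ p, Finsupp.single (z p) 1 = e} : k)

/-- The space `QSym(G)` of `G`-coloured quasi-symmetric functions. -/
def QSymG (k : Type u) [Field k] (G : Type v) [LinearOrder G] :
    Submodule k (MvPowerSeries (ℕ × G) k) :=
  Submodule.span k (Set.range (fundamentalF k))

/-- The value of the character `ζ_Q^G` at `F_c`, in the algebra `k[G]` of `k`-valued functions on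
`G` under pointwise operations, where `g ∈ G` stands for the indicator function of `g`:
it is `1` if `c = ()`, it is `g` if `c = (n)^g`, and it is `0` otherwise. -/
def zetaQ (k : Type u) [Field k] {G : Type v} [DecidableEq G] : GComposition G → (G → k)
  | [] => 1
  | [(_, g)] => Pi.single g 1
  | _ :: _ :: _ => 0

/-! ### The category of combinatorial `G`-coloured Hopf algebras -/

/-- A combinatorial `G`-coloured Hopf algebra: a connected graded Hopf algebra over `k` with
a `G`-character, that is, an algebra morphism to the algebra `k[G]` of functions on `G`. -/
structure ColouredHopf (k : Type u) [Field k] (G : Type v) where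
  carrier : Type w
  [ring : Ring carrier]
  [hopf : HopfAlgebra k carrier]
  /-- the homogeneous components -/
  grading : ℕ → Submodule k carrier
  internal : DirectSum.IsInternal grading
  gradedMonoid : SetLike.GradedMonoid grading
  comul_mem : ∀ n, ∀ x ∈ grading n,
    Coalgebra.comul (R := k) x ∈ ⨆ p ∈ Finset.HasAntidiagonal.antidiagonal n,
      LinearMap.range (TensorProduct.map (grading p.1).subtype (grading p.2).subtype)
  counit_eq_zero : ∀ n, n ≠ 0 → ∀ x ∈ grading n, Coalgebra.counit (R := k) x = 0
  antipode_mem : ∀ n, ∀ x ∈ grading n, HopfAlgebra.antipode k x ∈ grading n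
  connected : grading 0 = Submodule.span k {1}
  /-- the `G`-character -/
  character : carrier →ₐ[k] (G → k)

namespace ColouredHopf

variable {k : Type u} [Field k] {G : Type v}

instance (X : ColouredHopf.{u, v, w} k G) : Ring X.carrier := X.ring

instance (X : ColouredHopf.{u, v, w} k G) : HopfAlgebra k X.carrier := X.hopf

/-- Morphisms: graded morphisms of Hopf algebras that are compatible with the `G`-characters.
(A morphism of bialgebras between Hopf algebras commutes with the antipodes.) -/
@[ext]
structure Hom (X : ColouredHopf.{u, v, w₁} k G) (Y : ColouredHopf.{u, v, w₂} k G) where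
  toBialgHom : X.carrier →ₐc[k] Y.carrier
  graded : ∀ n, ∀ x ∈ X.grading n, toBialgHom x ∈ Y.grading n
  comm : ∀ x, Y.character (toBialgHom x) = X.character x

/-- The identity morphism. -/
def Hom.id (X : ColouredHopf.{u, v, w} k G) : Hom X X where
  toBialgHom := BialgHom.id k X.carrier
  graded := fun _ _ hx => hx
  comm := fun _ => rfl

/-- Composition of morphisms. -/
def Hom.comp {X : ColouredHopf.{u, v, w₁} k G} {Y : ColouredHopf.{u, v, w₂} k G}
    {Z : ColouredHopf.{u, v, w₃} k G} (f : Hom X Y) (g : Hom Y Z) : Hom X Z where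
  toBialgHom := g.toBialgHom.comp f.toBialgHom
  graded := fun n x hx => g.graded n _ (f.graded n x hx)
  comm := fun x => (g.comm _).trans (f.comm x)

instance : CategoryTheory.Category (ColouredHopf.{u, v, w} k G) where
  Hom := Hom
  id := Hom.id
  comp := Hom.comp
  id_comp := fun _ => rfl
  comp_id := fun _ => rfl
  assoc := fun _ _ _ => rfl

/-- `Q` is the pair `(QSym(G), ζ_Q^G)`: the map `ι` identifies the algebra `Q` with the subspace
`QSym(G)` of the algebra of power series, and, writing `F_c` for the element of `Q` that
corresponds to the series `F_c`, the component of degree `n` is spanned by the `F_c` with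
`‖c‖ = n`, the coproduct is `Δ F_c = ∑_{i=0}^{‖c‖} F_{c_{≤ i}} ⊗ F_{c_{> i}}`, and the character
is `ζ_Q^G`. As the `F_c` span, this determines the whole structure (the counit and the antipode
of a Hopf algebra being determined by its product and coproduct). -/
def IsQSymG [LinearOrder G] (Q : ColouredHopf.{u, v, w} k G)
    (ι : Q.carrier →ₐ[k] MvPowerSeries (ℕ × G) k) : Prop :=
  Function.Injective ι ∧
  LinearMap.range ι.toLinearMap = QSymG k G ∧
  ∃ F : GComposition G → Q.carrier,
    (∀ c, ι (F c) = fundamentalF k c) ∧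
    (∀ n, Q.grading n = Submodule.span k {x | ∃ c, GComposition.size c = n ∧ F c = x}) ∧
    (∀ c, Coalgebra.comul (R := k) (F c) =
      ∑ i ∈ Finset.range (GComposition.size c + 1), F (c.initialPart i) ⊗ₜ[k] F (c.finalPart i)) ∧
    (∀ c, Q.character (F c) = zetaQ k c)

end ColouredHopf

end

/-! The proof passes to the monomial basis. The word of a monomial lists its exponents with their
colours, in the lexicographic order of the variables `(a, g)`; let `M_c` be the sum of all monomials
with word `c`. The conditions on an admissible tuple say that it increases lexicographically, weakly
everywhere and strictly at the cuts of `c`. Such a tuple is determined by its monomial, and it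
exists exactly when the word of the monomial refines `c`. Thus `F_c` is the sum of the `M_d` with
`d` refining `c` (`fundamentalF_apply`). A proper refinement has more parts, so this relation is
unitriangular and the `F_c` span the same space as the `M_c` (`wordBasis_mem_span_fundamental`).

In the basis `M` the structure is dual to a free algebra on the letters `m^g`. The coproduct is dual
to concatenation (`coord₂_comulMap`), and the product is dual to the rule sending `m^g` to the sum
of the `i^g ⊗ j^g` with `i + j = m`, where `0^g` is the empty word (`coord_mul`). The bialgebra
axioms become identities between words, and the antipode comes from a recursion on the number of
parts. The formula for the coproduct of `F_c` expresses that a concatenation refines `c` exactly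
when its two factors refine the two pieces of `c` cut at the right place (`refines_append`).

For the universal property, let `ζ_m^g` be the degree `m` component of the `g`-coordinate of the
character of `H`. In degree `m`, the `g`-coordinate of `ζ_Q` reads off the coordinate at `m^g`.
Compatibility with coproducts then forces the coordinate at `c` of a morphism to be the convolution
product of the `ζ_m^g` along `c` (`coord_hom_apply`). Conversely these functionals define a
morphism: degree makes all but finitely many vanish at a given element, and they split products by
the same rule as the coordinates do (`wordChar_mul`), because `ζ_0^g` is the counit by connectedness
(`partChar_zero`). -/

noncomputable section

open Finset.HasAntidiagonal (antidiagonal)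

namespace GComposition

variable {G : Type v}

/-! ### Words -/

@[simp] lemma size_nil : size ([] : GComposition G) = 0 := rfl

@[simp] lemma size_cons (x : ℕ+ × G) (c : GComposition G) : size (x :: c) = x.1 + size c := by
  simp [size]

@[simp] lemma size_append (c d : GComposition G) : size (c ++ d) = size c + size d := by
  simp [size]

lemma size_eq_zero_iff {c : GComposition G} : size c = 0 ↔ c = [] := by
  cases c <;> simp

lemma length_le_size (c : GComposition G) : c.length ≤ size c := by
  induction c with
  | nil => simp
  | cons x c ih => have := x.1.pos; simp; omega

/-- Every use of the finiteness of `G` passes through this lemma: it keeps the expansion of `F_c`,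
products in the monomial basis and the universal morphism within finite sums. -/
lemma finite_size_le [Finite G] (n : ℕ) : {c : GComposition G | size c ≤ n}.Finite := by
  induction n with
  | zero =>
    refine (Set.finite_singleton []).subset fun c hc => ?_
    simpa [size_eq_zero_iff] using hc
  | succ n ih =>
    have hI : (Set.Iic (⟨n + 1, n.succ_pos⟩ : ℕ+)).Finite := Set.finite_Iic _
    refine (((hI.prod (Set.finite_univ (α := G))).image2 List.cons ih).insert []).subset ?_
    rintro (_ | ⟨⟨m, g⟩, c⟩) hc
    · exact Or.inl rfl
    · have := PNat.pos m
      have hc' : (m : ℕ) + size c ≤ n + 1 := (size_cons (m, g) c).ge.trans hc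
      have h1 : (m : ℕ) ≤ n + 1 := by omega
      have h2 : size c ≤ n := by omega
      exact Or.inr ⟨(m, g), ⟨h1, trivial⟩, c, h2, rfl⟩

/-- Prepend a part of size `m` and colour `g`, which is omitted if `m = 0`. -/
def consPart (m : ℕ) (g : G) (c : GComposition G) : GComposition G :=
  if h : 0 < m then (⟨m, h⟩, g) :: c else c

@[simp] lemma consPart_zero (g : G) (c : GComposition G) : consPart 0 g c = c := rfl

@[simp] lemma consPart_coe (m : ℕ+) (g : G) (c : GComposition G) :
    consPart (m : ℕ) g c = (m, g) :: c :=
  (dif_pos m.pos).trans rfl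

lemma consPart_append (m : ℕ) (g : G) (c d : GComposition G) :
    consPart m g c ++ d = consPart m g (c ++ d) := by
  unfold consPart; split <;> simp

@[simp] lemma size_consPart (m : ℕ) (g : G) (c : GComposition G) :
    size (consPart m g c) = m + size c := by
  unfold consPart; split
  · simp
  · simp; omega

/-! ### Splittings of words -/

/-- The sum of `φ a b` over all ways to split each part `m^g` of the word into `i^g` and `j^g`
with `i + j = m`, where `a` and `b` collect the nonzero parts `i^g` and `j^g`, respectively. -/
def splitSum {A : Type*} [AddCommMonoid A] :
    GComposition G → (GComposition G → GComposition G → A) → A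
  | [], φ => φ [] []
  | (m, g) :: c, φ => ∑ p ∈ antidiagonal (m : ℕ),
      splitSum c fun a b => φ (consPart p.1 g a) (consPart p.2 g b)

section splitSum

variable {A : Type*} [AddCommMonoid A]

@[simp] lemma splitSum_nil (φ : GComposition G → GComposition G → A) :
    splitSum [] φ = φ [] [] := rfl

/-- For `m = 0` the sum has the single term `(0, 0)`, which adds no part on either side; an exponent
zero thus needs no separate treatment. -/
lemma splitSum_consPart (m : ℕ) (g : G) (c : GComposition G)
    (φ : GComposition G → GComposition G → A) :
    splitSum (consPart m g c) φ = ∑ p ∈ antidiagonal m,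
      splitSum c fun a b => φ (consPart p.1 g a) (consPart p.2 g b) := by
  obtain rfl | h := Nat.eq_zero_or_pos m
  · simp
  · simp [consPart, h, splitSum]

lemma splitSum_append (c d : GComposition G) (φ : GComposition G → GComposition G → A) :
    splitSum (c ++ d) φ =
      splitSum c fun a b => splitSum d fun a' b' => φ (a ++ a') (b ++ b') := by
  induction c generalizing φ with
  | nil => simp
  | cons x c ih => simp [splitSum, ih, consPart_append]

lemma map_splitSum {B F : Type*} [AddCommMonoid B] [FunLike F A B] [AddMonoidHomClass F A B]
    (f : F) (c : GComposition G) (φ : GComposition G → GComposition G → A) :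
    f (splitSum c φ) = splitSum c fun a b => f (φ a b) := by
  induction c generalizing φ with
  | nil => simp
  | cons x c ih => simp [splitSum, ih]

lemma splitSum_add (c : GComposition G) (φ ψ : GComposition G → GComposition G → A) :
    splitSum c (fun a b => φ a b + ψ a b) = splitSum c φ + splitSum c ψ := by
  induction c generalizing φ ψ with
  | nil => simp
  | cons x c ih => simp [splitSum, ih, Finset.sum_add_distrib]

/-- Splitting preserves total size, so only pairs of the right total size matter. This yields degree
bounds for products. -/
lemma splitSum_eq_zero (c : GComposition G) (φ : GComposition G → GComposition G → A)
    (h : ∀ a b, size a + size b = size c → φ a b = 0) : splitSum c φ = 0 := by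
  induction c generalizing φ with
  | nil => exact h [] [] rfl
  | cons x c ih =>
    refine Finset.sum_eq_zero fun p hp => ih _ fun a b hab => h _ _ ?_
    rw [Finset.HasAntidiagonal.mem_antidiagonal] at hp
    simp only [size_consPart, size_cons]
    omega

lemma mul_splitSum {R : Type*} [NonUnitalNonAssocSemiring R] (r : R) (c : GComposition G)
    (φ : GComposition G → GComposition G → R) :
    r * splitSum c φ = splitSum c fun a b => r * φ a b :=
  map_splitSum (AddMonoidHom.mulLeft r) c φ

lemma splitSum_mul {R : Type*} [NonUnitalNonAssocSemiring R] (r : R) (c : GComposition G)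
    (φ : GComposition G → GComposition G → R) :
    splitSum c φ * r = splitSum c fun a b => φ a b * r :=
  map_splitSum (AddMonoidHom.mulRight r) c φ

end splitSum

/-! ### Refinement -/

/-- `Refines c d`: the word `c` is obtained from `d` by cutting parts into parts of the same
colour. -/
def Refines : GComposition G → GComposition G → Prop
  | [], [] => True
  | [], _ :: _ => False
  | _ :: _, [] => False
  | (m, g) :: c, (n, h) :: d =>
    g = h ∧ (m = n ∧ Refines c d ∨ m < n ∧ Refines c ((n - m, h) :: d))

lemma Refines.refl (c : GComposition G) : Refines c c := by
  induction c with
  | nil => trivial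
  | cons x c ih => exact ⟨rfl, Or.inl ⟨rfl, ih⟩⟩

lemma pnat_sub_coe {m n : ℕ+} (h : m < n) : ((n - m : ℕ+) : ℕ) = n - m := by
  rw [PNat.sub_coe, if_pos h]

lemma Refines.size_eq {c d : GComposition G} (h : Refines c d) : size c = size d := by
  induction c generalizing d with
  | nil => cases d with
    | nil => rfl
    | cons => exact h.elim
  | cons x c ih =>
    obtain ⟨m, g⟩ := x
    cases d with
    | nil => exact h.elim
    | cons y d =>
      obtain ⟨n, g'⟩ := y
      obtain ⟨_, ⟨rfl, h⟩ | ⟨hlt, h⟩⟩ := h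
      · simp [ih h]
      · have := ih h
        have hlt' : (m : ℕ) < n := hlt
        simp only [size_cons, pnat_sub_coe hlt] at this ⊢
        omega

lemma Refines.length_le {c d : GComposition G} (h : Refines c d) : d.length ≤ c.length := by
  induction c generalizing d with
  | nil => cases d with
    | nil => rfl
    | cons => exact h.elim
  | cons x c ih =>
    obtain ⟨m, g⟩ := x
    cases d with
    | nil => exact h.elim
    | cons y d =>
      obtain ⟨n, g'⟩ := y
      obtain ⟨_, ⟨rfl, h⟩ | ⟨hlt, h⟩⟩ := h
      · simpa using ih h
      · have := ih h
        simp only [List.length_cons] at this ⊢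
        omega

lemma Refines.eq_of_length_le {c d : GComposition G} (h : Refines c d)
    (hl : c.length ≤ d.length) : c = d := by
  induction c generalizing d with
  | nil => cases d with
    | nil => rfl
    | cons => exact h.elim
  | cons x c ih =>
    obtain ⟨m, g⟩ := x
    cases d with
    | nil => exact h.elim
    | cons y d =>
      obtain ⟨n, g'⟩ := y
      obtain ⟨rfl, ⟨rfl, h⟩ | ⟨hlt, h⟩⟩ := h
      · rw [ih h (by simpa using hl)]
      · have := h.length_le
        simp only [List.length_cons] at this hl
        omega

/-! ### Cutting a word after its first units -/

lemma size_initialPart (c : GComposition G) {i : ℕ} (hi : i ≤ size c) :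
    size (c.initialPart i) = i := by
  induction c generalizing i with
  | nil => simp only [size_nil] at hi; simp [initialPart]; omega
  | cons x c ih =>
    obtain ⟨m, g⟩ := x
    simp only [size_cons] at hi
    simp only [initialPart]
    split_ifs with h1 h2
    · simp [ih (i := i - m) (by omega)]; omega
    · simp
    · simp; omega

@[simp] lemma initialPart_zero (c : GComposition G) : c.initialPart 0 = [] := by
  cases c <;> simp [initialPart]

@[simp] lemma finalPart_zero (c : GComposition G) : c.finalPart 0 = c := by
  cases c with
  | nil => rfl
  | cons x c => exact dif_pos x.1.pos

/-- The combinatorial content of the coproduct formula. Consuming the head of `u` leaves a shorter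
cut in what remains of `c`, to which induction applies; the delicate case is a cut inside the first
part of `c`. -/
lemma refines_append {u w c : GComposition G} :
    Refines (u ++ w) c ↔
      Refines u (c.initialPart (size u)) ∧ Refines w (c.finalPart (size u)) := by
  induction u generalizing c with
  | nil => simp [Refines]
  | cons x u ih =>
    obtain ⟨m, g⟩ := x
    cases c with
    | nil => simp [Refines, initialPart]
    | cons y c =>
      obtain ⟨n, h⟩ := y
      have hm := m.pos
      have hn := n.pos
      simp only [List.cons_append, size_cons, Refines, ih]
      obtain hlt | rfl | hlt := lt_trichotomy m n
      · have hlt' : (m : ℕ) < n := hlt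
        have hsub := pnat_sub_coe hlt
        simp only [hlt, hlt.ne, false_and, true_and, false_or, initialPart, finalPart, hsub]
        by_cases h1 : (n : ℕ) ≤ m + size u
        · have h2 : (n : ℕ) - m ≤ size u := by omega
          have h3 : ¬ (m + size u < (n : ℕ)) := by omega
          have h4 : ¬ (size u < (n : ℕ) - m) := by omega
          have h5 : m + size u - (n : ℕ) = size u - (n - m) := by omega
          simp only [h1, h2, h3, h4, h5, if_true, dif_neg, not_false_eq_true, Refines, hlt, hlt.ne,
            false_and, true_and, false_or, and_assoc]
        · have h2 : ¬ (n : ℕ) - m ≤ size u := by omega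
          have h3 : m + size u < (n : ℕ) := by omega
          have h4 : size u < (n : ℕ) - m := by omega
          have h5 : (n : ℕ) - m - size u = n - (m + size u) := by omega
          have h6 : 0 < m + size u := by omega
          simp only [h1, h2, h3, h4, h5, h6, if_false, dif_pos, Refines]
          -- The initial part is now the single part of size `m + size u`. The head `m` exhausts it
          -- if `u` is empty and is strictly smaller otherwise, which selects the branch of
          -- `Refines`.
          rcases Nat.eq_zero_or_pos (size u) with h0 | h0
          · have hu := size_eq_zero_iff.1 h0
            subst hu
            have hmm : m = (⟨m + size ([] : GComposition G), h6⟩ : ℕ+) := PNat.eq rfl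
            rw [← hmm]
            simp [Refines]
          · obtain ⟨r, hr⟩ : ∃ r : ℕ+, r = (⟨m + size u, h6⟩ : ℕ+) := ⟨_, rfl⟩
            have hrc : (r : ℕ) = m + size u := by rw [hr]; rfl
            rw [← hr]
            have hlt2 : m < r := PNat.coe_lt_coe m r |>.1 (by omega)
            have heq : r - m = (⟨size u, h0⟩ : ℕ+) :=
              PNat.eq ((pnat_sub_coe hlt2).trans (by rw [hrc]; exact Nat.add_sub_cancel_left _ _))
            simp only [hlt2, hlt2.ne, heq, false_and, true_and, false_or, h0, dif_pos, and_assoc]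
      · simp [initialPart, finalPart, Refines, and_assoc]
      -- A head larger than the first part of `c` cannot refine it, and that part is not shortened
      -- by the cut: both sides are false.
      · have hlt' : (n : ℕ) < m := hlt
        have h1 : (n : ℕ) ≤ m + size u := by omega
        simp [initialPart, Refines, h1, hlt.ne', hlt.not_gt]

lemma finite_refines [Finite G] (c : GComposition G) : {d : GComposition G | Refines d c}.Finite :=
  (finite_size_le (size c)).subset fun _ h => (Refines.size_eq h).le

/-- A word refined by a word with at most one part has itself at most one part. Hence `ζ_Q` will
take the same value at `F_c` and at `M_c`. -/
lemma refines_consPart_nil_iff (c : GComposition G) (g : G) :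
    Refines (consPart (size c) g []) c ↔ c = consPart (size c) g [] := by
  constructor
  · intro h
    obtain _ | ⟨⟨m, h'⟩, _ | ⟨y, c⟩⟩ := c
    · rfl
    · simp [Refines] at h
      simp [h]
    · have := h.length_le
      unfold consPart at this
      split at this <;> simp at this
  · intro h
    rw [← h]
    exact Refines.refl c

/-- The numbers `size (c.take j)`. -/
def partialSums (c : GComposition G) : Set ℕ := {t | ∃ j, t = size (c.take j)}

lemma zero_mem_partialSums (c : GComposition G) : 0 ∈ partialSums c := ⟨0, by simp⟩

lemma size_mem_partialSums (c : GComposition G) : size c ∈ partialSums c :=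
  ⟨c.length, by simp⟩

lemma mem_partialSums_cons {x : ℕ+ × G} {c : GComposition G} {t : ℕ} :
    t ∈ partialSums (x :: c) ↔ t = 0 ∨ ∃ s ∈ partialSums c, t = x.1 + s := by
  constructor
  · rintro ⟨_ | j, rfl⟩
    · simp
    · exact Or.inr ⟨_, ⟨j, rfl⟩, by simp⟩
  · rintro (rfl | ⟨_, ⟨j, rfl⟩, rfl⟩)
    · exact zero_mem_partialSums _
    · exact ⟨j + 1, by simp⟩

@[simp] lemma colourWord_nil : colourWord ([] : GComposition G) = [] := rfl

@[simp] lemma colourWord_cons (x : ℕ+ × G) (c : GComposition G) :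
    colourWord (x :: c) = List.replicate x.1 x.2 ++ colourWord c := by
  simp [colourWord]

@[simp] lemma length_colourWord (c : GComposition G) : (colourWord c).length = size c := by
  induction c with
  | nil => rfl
  | cons x c ih => simp [ih]

/-- Passes from the recursion on parts to positions, the language in which admissible tuples are
described. -/
lemma refines_iff {c d : GComposition G} :
    Refines c d ↔ colourWord c = colourWord d ∧ partialSums d ⊆ partialSums c := by
  induction c generalizing d with
  | nil =>
    cases d with
    | nil => simp [Refines]
    | cons y d =>
      have := y.1.pos
      simp only [Refines, colourWord_nil, colourWord_cons, false_iff, not_and]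
      intro h
      have := congr_arg List.length h
      simp at this
      omega
  | cons x c ih =>
    obtain ⟨m, g⟩ := x
    have hm := m.pos
    cases d with
    | nil =>
      simp only [Refines, colourWord_nil, colourWord_cons, false_iff, not_and]
      intro h
      have := congr_arg List.length h
      simp at this
    | cons y d =>
      obtain ⟨n, h⟩ := y
      have hn := n.pos
      simp only [Refines, ih]
      constructor
      · rintro ⟨rfl, ⟨rfl, h1, h2⟩ | ⟨hlt, h1, h2⟩⟩
        · refine ⟨by simp [h1], fun t ht => ?_⟩
          rw [mem_partialSums_cons] at ht ⊢
          exact ht.imp_right fun ⟨s, hs, e⟩ => ⟨s, h2 hs, e⟩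
        · have hlt' : (m : ℕ) < n := hlt
          refine ⟨?_, fun t ht => ?_⟩
          · simp only [colourWord_cons, h1, pnat_sub_coe hlt]
            rw [← List.append_assoc, ← List.replicate_add, Nat.add_sub_cancel' hlt'.le]
          · rw [mem_partialSums_cons] at ht ⊢
            refine ht.imp_right fun ⟨s, hs, e⟩ => ⟨n - m + s, h2 ?_, by simp at e ⊢; omega⟩
            rw [mem_partialSums_cons]
            exact Or.inr ⟨s, hs, by simp [pnat_sub_coe hlt]⟩
      · rintro ⟨h1, h2⟩
        have hgh : g = h := by
          have := congr_arg (·[0]?) h1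
          simpa [List.getElem?_append] using this
        subst hgh
        refine ⟨rfl, ?_⟩
        -- The first cut of `d` is also a cut of `c`, so the first part of `c` cannot reach beyond
        -- it.
        have hnm : (n : ℕ) ∈ partialSums ((m, g) :: c) :=
          h2 (mem_partialSums_cons.2 (Or.inr ⟨0, zero_mem_partialSums d, rfl⟩))
        obtain h0 | ⟨s, hs, e⟩ := mem_partialSums_cons.1 hnm
        · omega
        simp only at e
        obtain heq | hlt' : m = n ∨ m < n := (PNat.coe_le_coe m n |>.1 (by omega)).eq_or_lt
        · subst heq
          refine Or.inl ⟨rfl, by simpa using h1, fun t ht => ?_⟩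
          obtain h0 | ⟨s', hs', e'⟩ := mem_partialSums_cons.1
            (h2 (mem_partialSums_cons.2 (Or.inr ⟨t, ht, rfl⟩)))
          · simp at h0
          · simp only at e'
            rwa [Nat.add_left_cancel e']
        · have hlt : (m : ℕ) < n := hlt'
          refine Or.inr ⟨hlt', ?_, fun t ht => ?_⟩
          · simp only [colourWord_cons, pnat_sub_coe hlt'] at h1 ⊢
            rw [← Nat.add_sub_cancel' hlt.le, List.replicate_add, List.append_assoc] at h1
            simpa using h1
          · obtain rfl | ⟨r, hr, rfl⟩ := mem_partialSums_cons.1 ht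
            · exact zero_mem_partialSums c
            · obtain h0 | ⟨s', hs', e'⟩ := mem_partialSums_cons.1
                (h2 (mem_partialSums_cons.2 (Or.inr ⟨r, hr, rfl⟩)))
              · simp at h0
              · simp only [pnat_sub_coe hlt'] at e' ⊢
                rwa [show (n : ℕ) - m + r = s' by omega]

end GComposition

namespace GComposition

variable {G : Type v}

/-! ### Words of monomials -/

/-- The word of the parts `(e ℓ)^g`, for the letters `ℓ = (a, g)` of the list with `e ℓ ≠ 0`. -/
def wordAlong (L : List (ℕ × G)) (e : ℕ × G →₀ ℕ) : GComposition G :=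
  L.foldr (fun ℓ c => consPart (e ℓ) ℓ.2 c) []

@[simp] lemma wordAlong_nil (e : ℕ × G →₀ ℕ) : wordAlong [] e = [] := rfl

@[simp] lemma wordAlong_cons (ℓ : ℕ × G) (L : List (ℕ × G)) (e : ℕ × G →₀ ℕ) :
    wordAlong (ℓ :: L) e = consPart (e ℓ) ℓ.2 (wordAlong L e) := rfl

lemma wordAlong_congr {L : List (ℕ × G)} {e f : ℕ × G →₀ ℕ} (h : ∀ ℓ ∈ L, e ℓ = f ℓ) :
    wordAlong L e = wordAlong L f := by
  induction L with
  | nil => rfl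
  | cons ℓ L ih =>
    rw [wordAlong_cons, wordAlong_cons, h ℓ (by simp), ih fun x hx => h x (by simp [hx])]

lemma wordAlong_filter (L : List (ℕ × G)) (e : ℕ × G →₀ ℕ) :
    wordAlong (L.filter (e · ≠ 0)) e = wordAlong L e := by
  induction L with
  | nil => rfl
  | cons ℓ L ih => by_cases h : e ℓ = 0 <;> simp_all

/-- Factoring a monomial into two amounts to splitting each exponent independently. The induction
separates the exponent of the first letter from the rest. -/
lemma sum_antidiagonal_wordAlong [DecidableEq G] {A : Type*} [AddCommMonoid A]
    {L : List (ℕ × G)} (hL : L.Nodup) {e : ℕ × G →₀ ℕ} (he : ∀ ℓ, e ℓ ≠ 0 → ℓ ∈ L)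
    (φ : GComposition G → GComposition G → A) :
    ∑ p ∈ antidiagonal e, φ (wordAlong L p.1) (wordAlong L p.2) =
      splitSum (wordAlong L e) φ := by
  classical
  induction L generalizing e φ with
  | nil =>
    have : e = 0 := by ext ℓ; by_contra h; simpa using he ℓ h
    simp [this]
  | cons ℓ L ih =>
    obtain ⟨hℓ, hL⟩ := List.nodup_cons.1 hL
    have hne : ∀ x ∈ L, x ≠ ℓ := fun x hx h => hℓ (h ▸ hx)
    have h1 : wordAlong L e = wordAlong L (e.erase ℓ) :=
      wordAlong_congr fun x hx => by rw [Finsupp.erase_ne (hne x hx)]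
    rw [wordAlong_cons, h1, splitSum_consPart]
    have h2 : ∀ x, e.erase ℓ x ≠ 0 → x ∈ L := fun x hx => by
      by_cases hxl : x = ℓ
      · simp [hxl] at hx
      · rw [Finsupp.erase_ne hxl] at hx
        exact (List.mem_cons.1 (he x hx)).resolve_left hxl
    simp_rw [← ih hL h2]
    rw [← Finset.sum_product']
    refine Finset.sum_nbij'
      (fun p => ((p.1 ℓ, p.2 ℓ), (p.1.erase ℓ, p.2.erase ℓ)))
      (fun q => (Finsupp.single ℓ q.1.1 + q.2.1, Finsupp.single ℓ q.1.2 + q.2.2)) ?_ ?_ ?_ ?_ ?_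
    · rintro ⟨a, b⟩ hp
      have hp : a + b = e := by simpa using hp
      subst hp
      simp [Finsupp.erase_add]
    · rintro ⟨⟨i, j⟩, ⟨a, b⟩⟩ hq
      obtain ⟨h3, h4⟩ : i + j = e ℓ ∧ a + b = e.erase ℓ := by simpa using hq
      simp only [Finset.HasAntidiagonal.mem_antidiagonal]
      rw [add_add_add_comm, ← Finsupp.single_add, h3, h4, Finsupp.single_add_erase]
    · rintro ⟨a, b⟩ hp
      simp [Finsupp.single_add_erase]
    · rintro ⟨⟨i, j⟩, ⟨a, b⟩⟩ hq
      obtain ⟨h3, h4⟩ : i + j = e ℓ ∧ a + b = e.erase ℓ := by simpa using hq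
      have h5 : a ℓ + b ℓ = 0 := by simpa using DFunLike.congr_fun h4 ℓ
      have ha : a ℓ = 0 := by omega
      have hb : b ℓ = 0 := by omega
      simp [ha, hb, Finsupp.erase_add]
    · rintro ⟨a, b⟩ -
      simp only [wordAlong_cons]
      rw [wordAlong_congr (f := a.erase ℓ) fun x hx => (Finsupp.erase_ne (hne x hx)).symm,
        wordAlong_congr (f := b.erase ℓ) fun x hx => (Finsupp.erase_ne (hne x hx)).symm]

/-- The letters `(s, g₁), (s + 1, g₂), …` for a word with the colours `g₁, g₂, …`. -/
def standardLetters : ℕ → GComposition G → List (ℕ × G)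
  | _, [] => []
  | s, (_, g) :: c => (s, g) :: standardLetters (s + 1) c

/-- The exponent vector of the monomial `∏ i, (s + i, gᵢ) ^ mᵢ`. -/
def standardMonomial : ℕ → GComposition G → (ℕ × G →₀ ℕ)
  | _, [] => 0
  | s, (m, g) :: c => Finsupp.single (s, g) (m : ℕ) + standardMonomial (s + 1) c

lemma le_of_mem_standardLetters {s : ℕ} {c : GComposition G} {ℓ : ℕ × G}
    (h : ℓ ∈ standardLetters s c) : s ≤ ℓ.1 := by
  induction c generalizing s with
  | nil => simp [standardLetters] at h
  | cons x c ih =>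
    obtain rfl | h := List.mem_cons.1 h
    · exact le_rfl
    · exact (Nat.le_succ s).trans (ih h)

lemma mem_standardLetters {s : ℕ} {c : GComposition G} {ℓ : ℕ × G}
    (h : standardMonomial s c ℓ ≠ 0) : ℓ ∈ standardLetters s c := by
  classical
  induction c generalizing s with
  | nil => simp [standardMonomial] at h
  | cons x c ih =>
    by_cases hℓ : ℓ = (s, x.2)
    · simp [standardLetters, hℓ]
    · refine List.mem_cons_of_mem _ (ih ?_)
      simpa [standardMonomial, Finsupp.single_apply, Ne.symm hℓ] using h

variable [LinearOrder G]

/-- The support of an exponent vector, sorted lexicographically. -/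
def sortedSupport (e : ℕ × G →₀ ℕ) : List (ℕ × G) :=
  (e.support.map toLex.toEmbedding).sort.map ofLex

lemma mem_sortedSupport {e : ℕ × G →₀ ℕ} {ℓ : ℕ × G} : ℓ ∈ sortedSupport e ↔ e ℓ ≠ 0 := by
  simp [sortedSupport]

lemma pairwise_sortedSupport (e : ℕ × G →₀ ℕ) :
    (sortedSupport e).Pairwise (fun a b => toLex a < toLex b) := by
  rw [sortedSupport, List.pairwise_map]
  exact (Finset.sortedLT_sort _).pairwise

lemma nodup_of_pairwise_toLex_lt {L : List (ℕ × G)}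
    (hL : L.Pairwise (fun a b => toLex a < toLex b)) : L.Nodup :=
  hL.imp fun h h' => by simp [h'] at h

/-- The word of a monomial: the parts `(e (a, g))^g`, in the lexicographic order of the `(a, g)`
in the support of `e`. -/
def monomialWord (e : ℕ × G →₀ ℕ) : GComposition G := wordAlong (sortedSupport e) e

/-- Letters with exponent zero contribute no part. The words of a product and of its two factors can
therefore be read along one common list. -/
lemma wordAlong_eq_monomialWord {L : List (ℕ × G)}
    (hL : L.Pairwise (fun a b => toLex a < toLex b)) {e : ℕ × G →₀ ℕ}
    (he : ∀ ℓ, e ℓ ≠ 0 → ℓ ∈ L) : wordAlong L e = monomialWord e := by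
  rw [← wordAlong_filter, monomialWord]
  congr 1
  refine List.Perm.eq_of_pairwise (le := fun a b => toLex a < toLex b)
    (fun _ _ _ _ h h' => (lt_asymm h h').elim) (hL.filter _) (pairwise_sortedSupport e) ?_
  rw [List.perm_ext_iff_of_nodup ((nodup_of_pairwise_toLex_lt hL).filter _)
    (nodup_of_pairwise_toLex_lt (pairwise_sortedSupport e))]
  intro ℓ
  simpa [mem_sortedSupport] using he ℓ

lemma sum_antidiagonal_monomialWord {A : Type*} [AddCommMonoid A] (e : ℕ × G →₀ ℕ)
    (φ : GComposition G → GComposition G → A) :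
    ∑ p ∈ antidiagonal e, φ (monomialWord p.1) (monomialWord p.2) =
      splitSum (monomialWord e) φ := by
  have hL := pairwise_sortedSupport e
  rw [monomialWord, ← sum_antidiagonal_wordAlong (nodup_of_pairwise_toLex_lt hL)
    fun ℓ => mem_sortedSupport.2]
  refine Finset.sum_congr rfl fun p hp => ?_
  obtain ⟨a, b⟩ := p
  have hp : a + b = e := by simpa using hp
  subst hp
  have ha : ∀ ℓ, a ℓ ≠ 0 → ℓ ∈ sortedSupport (a + b) := fun ℓ h =>
    mem_sortedSupport.2 fun h' => h (Nat.eq_zero_of_add_eq_zero h').1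
  have hb : ∀ ℓ, b ℓ ≠ 0 → ℓ ∈ sortedSupport (a + b) := fun ℓ h =>
    mem_sortedSupport.2 fun h' => h (Nat.eq_zero_of_add_eq_zero h').2
  rw [wordAlong_eq_monomialWord hL ha, wordAlong_eq_monomialWord hL hb]

@[simp] lemma monomialWord_zero : monomialWord (0 : ℕ × G →₀ ℕ) = [] := by
  rw [← wordAlong_eq_monomialWord (L := []) (by simp) (by simp), wordAlong_nil]

lemma pairwise_standardLetters (s : ℕ) (c : GComposition G) :
    (standardLetters s c).Pairwise (fun a b => toLex a < toLex b) := by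
  induction c generalizing s with
  | nil => exact List.Pairwise.nil
  | cons x c ih =>
    refine List.pairwise_cons.2 ⟨fun ℓ h => ?_, ih _⟩
    rw [Prod.Lex.toLex_lt_toLex]
    exact Or.inl (le_of_mem_standardLetters h)

lemma eq_zero_of_monomialWord_eq_nil {e : ℕ × G →₀ ℕ} (h : monomialWord e = []) : e = 0 := by
  have key : ∀ L : List (ℕ × G), wordAlong L e = [] → ∀ ℓ ∈ L, e ℓ = 0 := by
    intro L
    induction L with
    | nil => simp
    | cons x L ih =>
      intro h
      have hs := congr_arg size h
      rw [wordAlong_cons, size_consPart, size_nil] at hs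
      have hL := size_eq_zero_iff.1 (Nat.eq_zero_of_add_eq_zero hs).2
      exact List.forall_mem_cons.2 ⟨(Nat.eq_zero_of_add_eq_zero hs).1, ih hL⟩
  ext ℓ
  by_contra hℓ
  exact hℓ (key _ h ℓ (mem_sortedSupport.2 hℓ))

/-- The first components of the letters increase strictly, so the colours may come in any order.
Every word thus occurs, and coordinates can be recovered from coefficients. -/
lemma monomialWord_standardMonomial (s : ℕ) (c : GComposition G) :
    monomialWord (standardMonomial s c) = c := by
  classical
  rw [← wordAlong_eq_monomialWord (pairwise_standardLetters s c) fun ℓ => mem_standardLetters]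
  induction c generalizing s with
  | nil => rfl
  | cons x c ih =>
    obtain ⟨m, g⟩ := x
    have h0 : standardMonomial (s + 1) c (s, g) = 0 := by
      by_contra h
      have := le_of_mem_standardLetters (mem_standardLetters h)
      simp at this
    simp only [standardLetters, standardMonomial, wordAlong_cons, Finsupp.add_apply, h0,
      Finsupp.single_eq_same, add_zero, consPart_coe]
    congr 1
    refine (wordAlong_congr fun ℓ h => ?_).trans (ih (s + 1))
    have : (s, g) ≠ ℓ := by
      rintro rfl
      have := le_of_mem_standardLetters h
      simp at this
    simp [this]

end GComposition

namespace GComposition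

variable {G : Type v}

/-! ### The coefficients of the fundamental coloured quasi-symmetric functions -/

lemma colourWord_consPart (m : ℕ) (g : G) (c : GComposition G) :
    colourWord (consPart m g c) = List.replicate m g ++ colourWord c := by
  unfold consPart; split
  · simp
  · have : m = 0 := by omega
    simp [this]

lemma mem_partialSums_consPart {m : ℕ} {g : G} {c : GComposition G} {t : ℕ} :
    t ∈ partialSums (consPart m g c) ↔ t = 0 ∨ ∃ s ∈ partialSums c, t = m + s := by
  unfold consPart; split
  · simp [mem_partialSums_cons]
  · have : m = 0 := by omega
    subst this
    simpa using fun h => h ▸ zero_mem_partialSums c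

/-- The letters of the list, each letter `ℓ` being repeated `e ℓ` times. -/
def expandAlong (L : List (ℕ × G)) (e : ℕ × G →₀ ℕ) : List (ℕ × G) :=
  L.flatMap fun ℓ => List.replicate (e ℓ) ℓ

@[simp] lemma expandAlong_nil (e : ℕ × G →₀ ℕ) : expandAlong [] e = [] := rfl

@[simp] lemma expandAlong_cons (ℓ : ℕ × G) (L : List (ℕ × G)) (e : ℕ × G →₀ ℕ) :
    expandAlong (ℓ :: L) e = List.replicate (e ℓ) ℓ ++ expandAlong L e := by
  simp [expandAlong]

lemma mem_of_mem_expandAlong {L : List (ℕ × G)} {e : ℕ × G →₀ ℕ} {ℓ : ℕ × G}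
    (h : ℓ ∈ expandAlong L e) : ℓ ∈ L := by
  obtain ⟨x, hx, h⟩ := List.mem_flatMap.1 h
  exact (List.eq_of_mem_replicate h) ▸ hx

lemma map_snd_expandAlong (L : List (ℕ × G)) (e : ℕ × G →₀ ℕ) :
    (expandAlong L e).map Prod.snd = colourWord (wordAlong L e) := by
  induction L with
  | nil => rfl
  | cons ℓ L ih => simp [colourWord_consPart, ih]

lemma count_expandAlong [DecidableEq G] {L : List (ℕ × G)} (hL : L.Nodup) (e : ℕ × G →₀ ℕ)
    (ℓ : ℕ × G) : (expandAlong L e).count ℓ = if ℓ ∈ L then e ℓ else 0 := by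
  induction L with
  | nil => rfl
  | cons x L ih =>
    obtain ⟨hx, hL⟩ := List.nodup_cons.1 hL
    rw [expandAlong_cons, List.count_append, List.count_replicate, ih hL]
    by_cases h : x = ℓ
    · subst h; simp [hx]
    · simp [h, Ne.symm h]

/-- The blocks consist of copies of pairwise distinct letters, so neighbours differ precisely at
block boundaries. -/
lemma getElem?_expandAlong_ne_iff {L : List (ℕ × G)} (hL : L.Nodup) (e : ℕ × G →₀ ℕ) (p : ℕ)
    (x y : ℕ × G) (hx : (expandAlong L e)[p]? = some x)
    (hy : (expandAlong L e)[p + 1]? = some y) :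
    x ≠ y ↔ p + 1 ∈ partialSums (wordAlong L e) := by
  induction L generalizing p with
  | nil => simp at hx
  | cons ℓ L ih =>
    obtain ⟨hℓ, hL⟩ := List.nodup_cons.1 hL
    rw [wordAlong_cons, mem_partialSums_consPart]
    rw [expandAlong_cons, List.getElem?_append] at hx hy
    simp only [List.length_replicate] at hx hy
    obtain h | h | h := lt_trichotomy (p + 1) (e ℓ)
    · rw [if_pos h, List.getElem?_replicate, if_pos h] at hy
      rw [if_pos (by omega), List.getElem?_replicate, if_pos (by omega)] at hx
      have hxy : x = y := by simp_all
      simp only [hxy, ne_eq, not_true_eq_false, false_iff, not_or, not_exists, not_and]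
      exact ⟨by omega, fun s _ => by omega⟩
    -- Here `x` is the last copy of `ℓ`, while `y` comes from `L`, which does not contain `ℓ`.
    · rw [if_pos (by omega), List.getElem?_replicate, if_pos (by omega)] at hx
      rw [if_neg (by omega)] at hy
      have hy' := mem_of_mem_expandAlong (List.mem_of_getElem? hy)
      obtain rfl : ℓ = x := by simpa using hx
      refine iff_of_true (fun h' => hℓ (h' ▸ hy')) (Or.inr ⟨0, zero_mem_partialSums _, by omega⟩)
    · rw [if_neg (by omega)] at hx hy
      rw [show p + 1 - e ℓ = p - e ℓ + 1 by omega] at hy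
      rw [ih hL _ hx hy]
      constructor
      · exact fun h' => Or.inr ⟨_, h', by omega⟩
      · rintro (h' | ⟨s, hs, h'⟩)
        · omega
        · rwa [show p - e ℓ + 1 = s by omega]

lemma colourWord_boundary {d : GComposition G} {j : ℕ} (hj : j + 1 < d.length) {p : ℕ}
    (hp : p + 1 = size (d.take (j + 1))) :
    (colourWord d)[p]? = some d[j].2 ∧ (colourWord d)[p + 1]? = some d[j + 1].2 := by
  induction d generalizing j p with
  | nil => simp at hj
  | cons x d ih =>
    simp only [colourWord_cons, List.getElem?_append, List.length_replicate]
    rw [List.take_succ_cons, size_cons] at hp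
    obtain _ | j := j
    · simp only [List.take_zero, size_nil, add_zero] at hp
      obtain _ | ⟨y, d⟩ := d
      · simp at hj
      · rw [if_pos (by omega), if_neg (by omega), hp, Nat.sub_self]
        have := y.1.pos
        have := x.1.pos
        simp [show p < x.1 by omega]
    · simp only [List.length_cons] at hj
      have hpos : 0 < size (d.take (j + 1)) := by
        obtain _ | ⟨y, d⟩ := d
        · simp at hj
        · simp
      rw [if_neg (by omega), if_neg (by omega), show p + 1 - x.1 = p - x.1 + 1 by omega]
      simpa using ih (j := j) (by omega) (p := p - x.1) (by omega)

lemma colourWord_succ_eq {c : GComposition G} {p : ℕ} (hp : p + 1 < size c)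
    (h : p + 1 ∉ partialSums c) : (colourWord c)[p]? = (colourWord c)[p + 1]? := by
  induction c generalizing p with
  | nil => simp at hp
  | cons x c ih =>
    simp only [colourWord_cons, List.getElem?_append, List.length_replicate]
    simp only [mem_partialSums_cons, not_or, not_exists, not_and] at h
    have h0 := h.2 0 (zero_mem_partialSums c)
    rw [size_cons] at hp
    obtain h1 | h1 := Nat.lt_or_gt_of_ne h0
    · simp only [add_zero] at h1
      simp [h1, show p < x.1 by omega]
    · rw [if_neg (by omega), if_neg (by omega), show p + 1 - x.1 = p - x.1 + 1 by omega]
      exact ih (by omega) fun h' => h.2 _ h' (by omega)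

lemma exists_of_mem_partialSums {c : GComposition G} {t : ℕ} (ht : t ∈ partialSums c)
    (h0 : 0 < t) (hn : t < size c) : ∃ j, j + 1 < c.length ∧ t = size (c.take (j + 1)) := by
  obtain ⟨_ | j, rfl⟩ := ht
  · simp at h0
  · refine ⟨j, ?_, rfl⟩
    by_contra h
    rw [List.take_of_length_le (by omega)] at hn
    exact hn.false

/-! ### Admissible tuples as lexicographically sorted lists -/

variable [LinearOrder G]

/-- At a cut, requiring `a < a'` when `g ≥ g'` and `a ≤ a'` otherwise is the same as strict
lexicographic increase; between cuts the colour is constant, so weak increase of the letters is weak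
lexicographic increase. -/
lemma isAdmissible_iff {d : GComposition G} {z : Fin d.size → ℕ × G} :
    d.IsAdmissible z ↔ (List.ofFn z).map Prod.snd = colourWord d ∧
      (List.ofFn z).Pairwise (fun a b => toLex a ≤ toLex b) ∧
      ∀ p q : Fin d.size, (p : ℕ) + 1 = q → (q : ℕ) ∈ partialSums d → z p ≠ z q := by
  have hcol : (∀ p : Fin d.size, d.colourWord[(p : ℕ)]? = some (z p).2) ↔
      (List.ofFn z).map Prod.snd = colourWord d := by
    constructor
    · intro h
      refine List.ext_getElem? fun i => ?_
      by_cases hi : i < d.size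
      · rw [h ⟨i, hi⟩]; simp [hi]
      · rw [List.getElem?_eq_none (by simpa using hi), List.getElem?_eq_none (by simpa using hi)]
    · intro h p
      rw [← h]
      simp
  rw [IsAdmissible, hcol]
  refine and_congr_right fun h => ?_
  rw [← hcol] at h
  have key : ∀ p q : Fin d.size, (p : ℕ) + 1 = q → (q : ℕ) ∈ partialSums d →
      ∃ (j : ℕ) (hj : j + 1 < d.length), (q : ℕ) = size (d.take (j + 1)) ∧
        (z p).2 = d[j].2 ∧ (z q).2 = d[j + 1].2 := by
    intro p q hpq hq
    obtain ⟨j, hj, hj'⟩ := exists_of_mem_partialSums hq (by omega) q.2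
    have hb := colourWord_boundary hj (hpq.trans hj')
    have hp := h p
    have hq' := h q
    rw [← hpq] at hq'
    rw [hb.1] at hp
    rw [hb.2] at hq'
    exact ⟨j, hj, hj', (Option.some.inj hp).symm, (Option.some.inj hq').symm⟩
  constructor
  · rintro ⟨hmono, hstrict⟩
    have hstep : ∀ p q : Fin d.size, (p : ℕ) + 1 = q → toLex (z p) ≤ toLex (z q) ∧
        ((q : ℕ) ∈ partialSums d → z p ≠ z q) := by
      intro p q hpq
      have hle : (z p).1 ≤ (z q).1 := hmono (Fin.le_def.2 (by omega))
      by_cases hq : (q : ℕ) ∈ partialSums d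
      · obtain ⟨j, hj, hj', hp2, hq2⟩ := key p q hpq hq
        have hlt : toLex (z p) < toLex (z q) := by
          rw [Prod.Lex.toLex_lt_toLex]
          by_cases hg : d[j].2 ≥ d[j + 1].2
          · exact Or.inl (hstrict j hj p q hj' hpq hg)
          · refine hle.lt_or_eq.imp_right fun heq => ⟨heq, ?_⟩
            rw [hp2, hq2]
            exact not_le.1 hg
        exact ⟨hlt.le, fun _ heq => hlt.ne (congr_arg toLex heq)⟩
      · refine ⟨?_, fun h' => (hq h').elim⟩
        have h2 := colourWord_succ_eq (c := d) (p := p) (by omega) (by rwa [hpq])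
        rw [hpq, h p, h q, Option.some_inj] at h2
        rw [Prod.Lex.toLex_le_toLex]
        exact hle.lt_or_eq.imp_right fun heq => ⟨heq, h2.le⟩
    refine ⟨?_, fun p q hpq => (hstep p q hpq).2⟩
    have hchain : ∀ (r : ℕ) (p q : Fin d.size), (p : ℕ) + r = q → toLex (z p) ≤ toLex (z q) := by
      intro r
      induction r with
      | zero => exact fun p q hpq => by rw [Fin.ext hpq]
      | succ r ih =>
        intro p q hpq
        have hr : (p : ℕ) + r < d.size := by omega
        exact (ih p ⟨p + r, hr⟩ rfl).trans (hstep ⟨p + r, hr⟩ q hpq).1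
    rw [List.pairwise_ofFn]
    exact fun p q hpq => hchain (q - p) p q (by have := Fin.lt_def.1 hpq; omega)
  · rintro ⟨hpw, hne⟩
    rw [List.pairwise_ofFn] at hpw
    have hmono : Monotone fun p => toLex (z p) := monotone_iff_forall_lt.2 fun p q hpq => hpw hpq
    refine ⟨fun p q hpq => ?_, ?_⟩
    · have := hmono hpq
      simp only [Prod.Lex.toLex_le_toLex] at this
      exact this.elim le_of_lt fun h' => h'.1.le
    · intro j hj p q hq hpq hg
      have hmem : (q : ℕ) ∈ partialSums d := ⟨_, hq⟩
      have hle := hmono (show p ≤ q from Fin.le_def.2 (by omega))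
      have hlt := lt_of_le_of_ne hle fun h' => hne p q hpq hmem (toLex.injective h')
      have hb := colourWord_boundary hj (hpq.trans hq)
      have hp2 := h p
      have hq2 := h q
      rw [← hpq] at hq2
      rw [hb.1, Option.some_inj] at hp2
      rw [hb.2, Option.some_inj] at hq2
      rw [Prod.Lex.toLex_lt_toLex] at hlt
      -- With equal letters, strict lexicographic increase would force `d[j].2 < d[j + 1].2`,
      -- against `hg`.
      refine hlt.resolve_right fun h' => ?_
      rw [← hp2, ← hq2] at h'
      exact absurd h'.2 hg.not_gt

lemma sum_single_ofFn_apply {n : ℕ} (z : Fin n → ℕ × G) (ℓ : ℕ × G) :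
    (∑ p, Finsupp.single (z p) 1 : ℕ × G →₀ ℕ) ℓ = (List.ofFn z).count ℓ := by
  have : ∀ l : List (ℕ × G),
      ((l.map fun x => Finsupp.single x 1).sum : ℕ × G →₀ ℕ) ℓ = l.count ℓ := by
    intro l
    induction l with
    | nil => rfl
    | cons x l ih =>
      rw [List.map_cons, List.sum_cons, Finsupp.add_apply, ih, List.count_cons, add_comm,
        Finsupp.single_apply]
      simp
  rw [← this, List.map_ofFn, List.sum_ofFn]
  rfl

-- An admissible tuple is sorted, so its monomial determines it: the only candidate is the sorted
-- list of the letters with multiplicity. Its strict increases are the cuts of the word of `e`,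
-- which must include those of `c`.
open Classical in
lemma card_isAdmissible (c : GComposition G) (e : ℕ × G →₀ ℕ) :
    Nat.card {z : Fin c.size → ℕ × G //
      c.IsAdmissible z ∧ ∑ p, Finsupp.single (z p) 1 = e} =
      if Refines (monomialWord e) c then 1 else 0 := by
  set L := sortedSupport e with hLdef
  have hLp := pairwise_sortedSupport e
  have hL : L.Nodup := nodup_of_pairwise_toLex_lt hLp
  have hcount : ∀ ℓ, (expandAlong L e).count ℓ = e ℓ := by
    intro ℓ
    rw [count_expandAlong hL]
    split_ifs with h
    · rfl
    · rw [mem_sortedSupport, not_not] at h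
      exact h.symm
  have hsort : (expandAlong L e).Pairwise (fun a b => toLex a ≤ toLex b) := by
    rw [expandAlong, List.pairwise_flatMap]
    refine ⟨fun a _ => List.pairwise_replicate.2 (Or.inr le_rfl), hLp.imp fun h x hx y hy => ?_⟩
    rw [List.eq_of_mem_replicate hx, List.eq_of_mem_replicate hy]
    exact h.le
  have huniq : ∀ z : Fin c.size → ℕ × G, c.IsAdmissible z → ∑ p, Finsupp.single (z p) 1 = e →
      List.ofFn z = expandAlong L e := by
    intro z hz he
    refine List.Perm.eq_of_pairwise (le := fun a b => toLex a ≤ toLex b)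
      (fun _ _ _ _ h h' => toLex.injective (le_antisymm h h')) (isAdmissible_iff.1 hz).2.1 hsort ?_
    rw [List.perm_iff_count]
    intro ℓ
    rw [hcount, ← sum_single_ofFn_apply, he]
  have hsub : Subsingleton {z : Fin c.size → ℕ × G //
      c.IsAdmissible z ∧ ∑ p, Finsupp.single (z p) 1 = e} :=
    ⟨fun z z' => Subtype.ext (List.ofFn_injective
      ((huniq _ z.2.1 z.2.2).trans (huniq _ z'.2.1 z'.2.2).symm))⟩
  have hcol : (expandAlong L e).map Prod.snd = colourWord (monomialWord e) :=
    map_snd_expandAlong L e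
  split_ifs with href
  · rw [refines_iff] at href
    have hlen : (expandAlong L e).length = c.size := by
      rw [← length_colourWord, ← href.1, ← hcol, List.length_map]
    obtain ⟨z, hz⟩ : ∃ z : Fin c.size → ℕ × G, List.ofFn z = expandAlong L e := by
      rw [← hlen]
      exact ⟨_, List.ofFn_get _⟩
    refine Nat.card_eq_one_iff_unique.2 ⟨hsub, ⟨z, isAdmissible_iff.2 ⟨?_, ?_, ?_⟩, ?_⟩⟩
    · rw [hz, hcol, href.1]
    · rwa [hz]
    · intro p q hpq hq
      refine (getElem?_expandAlong_ne_iff hL e p _ _ ?_ ?_).2 (hpq ▸ href.2 hq)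
      · simp [← hz]
      · simp [← hz, hpq]
    · ext ℓ
      rw [sum_single_ofFn_apply, hz, hcount]
  · have : IsEmpty {z : Fin c.size → ℕ × G //
        c.IsAdmissible z ∧ ∑ p, Finsupp.single (z p) 1 = e} := by
      refine ⟨fun ⟨z, hz, he⟩ => href (refines_iff.2 ?_)⟩
      have hl := huniq z hz he
      obtain ⟨h1, h2, h3⟩ := isAdmissible_iff.1 hz
      have hcw : colourWord (monomialWord e) = colourWord c := by rw [← hcol, ← hl, h1]
      have hsize : size (monomialWord e) = size c := by
        rw [← length_colourWord, hcw, length_colourWord]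
      refine ⟨hcw, fun t ht => ?_⟩
      -- The extreme partial sums `0` and `size c` impose no condition; only interior cuts compare
      -- two neighbouring letters.
      obtain h0 | h0 := Nat.eq_zero_or_pos t
      · exact h0 ▸ zero_mem_partialSums _
      have hle : t ≤ size c := by
        obtain ⟨j, rfl⟩ := ht
        conv_rhs => rw [← List.take_append_drop j c, size_append]
        exact Nat.le_add_right _ _
      obtain hn | hn := hle.eq_or_lt
      · rw [hn, ← hsize]
        exact size_mem_partialSums _
      · obtain ⟨p, rfl⟩ : ∃ p, t = p + 1 := ⟨t - 1, by omega⟩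
        have hp : p < size c := by omega
        refine (getElem?_expandAlong_ne_iff hL e p (z ⟨p, hp⟩) (z ⟨p + 1, hn⟩) ?_ ?_).1
          (h3 ⟨p, hp⟩ ⟨p + 1, hn⟩ rfl ht)
        · simp [← hl, hp]
        · simp [← hl, hn]
    exact Nat.card_of_isEmpty

end GComposition

-- In the monomial basis, this is the expansion of `F_c` over the refinements of `c`.
open Classical in
lemma fundamentalF_apply (k : Type u) [Field k] {G : Type v} [LinearOrder G]
    (c : GComposition G) (e : ℕ × G →₀ ℕ) :
    fundamentalF k c e = if (GComposition.monomialWord e).Refines c then 1 else 0 := by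
  rw [fundamentalF, GComposition.card_isAdmissible]
  split_ifs <;> simp

open GComposition

/-! ### The bialgebra of coloured quasi-symmetric functions -/

/-- The coefficient with respect to the tensor product of two bases. -/
lemma Module.Basis.tensorProduct_repr_apply {k M N ι κ : Type*} [CommRing k] [AddCommGroup M]
    [Module k M] [AddCommGroup N] [Module k N] (b : Module.Basis ι k M) (c : Module.Basis κ k N)
    (t : M ⊗[k] N) (i : ι) (j : κ) :
    (b.tensorProduct c).repr t (i, j) =
      LinearMap.mul' k k (TensorProduct.map (b.coord i) (c.coord j) t) := by
  induction t with
  | zero => simp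
  | tmul x y => simp [mul_comm]
  | add x y hx hy => simp [hx, hy]

lemma Module.Basis.ext_tensor_cube {k M ι : Type*} [CommRing k] [AddCommGroup M]
    [Module k M] (b : Module.Basis ι k M) {s t : M ⊗[k] (M ⊗[k] M)}
    (h : ∀ i j l,
      LinearMap.mul' k k (TensorProduct.map (b.coord i)
        (LinearMap.mul' k k ∘ₗ TensorProduct.map (b.coord j) (b.coord l)) s) =
      LinearMap.mul' k k (TensorProduct.map (b.coord i)
        (LinearMap.mul' k k ∘ₗ TensorProduct.map (b.coord j) (b.coord l)) t)) : s = t := by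
  refine (b.tensorProduct (b.tensorProduct b)).repr.injective (Finsupp.ext ?_)
  rintro ⟨i, j, l⟩
  have h₂ : (b.tensorProduct b).coord (j, l) =
      LinearMap.mul' k k ∘ₗ TensorProduct.map (b.coord j) (b.coord l) :=
    LinearMap.ext fun t => Module.Basis.tensorProduct_repr_apply _ _ t j l
  rw [Module.Basis.tensorProduct_repr_apply, Module.Basis.tensorProduct_repr_apply, h₂]
  exact h i j l

/-- Moves functionals across one side of an iterated coproduct, so that coassociativity can be
tested on coordinates. -/
lemma TensorProduct.mul'_map_assoc_rTensor {k M : Type*} [CommRing k] [AddCommGroup M] [Module k M]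
    (D : M →ₗ[k] M ⊗[k] M) (f g h : M →ₗ[k] k) (t : M ⊗[k] M) :
    LinearMap.mul' k k (TensorProduct.map f (LinearMap.mul' k k ∘ₗ TensorProduct.map g h)
      (TensorProduct.assoc k M M M (D.rTensor M t))) =
    LinearMap.mul' k k
      (TensorProduct.map ((LinearMap.mul' k k ∘ₗ TensorProduct.map f g) ∘ₗ D) h t) := by
  induction t with
  | zero => simp
  | add x y hx hy => simp only [map_add, hx, hy]
  | tmul x y =>
    rw [LinearMap.rTensor_tmul, TensorProduct.map_tmul, LinearMap.comp_apply]
    generalize D x = s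
    induction s with
    | zero => simp
    | add x y hx hy => simp only [TensorProduct.add_tmul, map_add, hx, hy]
    | tmul a b => simp [mul_assoc]

lemma TensorProduct.mul'_map_lTensor {k M : Type*} [CommRing k] [AddCommGroup M] [Module k M]
    (D : M →ₗ[k] M ⊗[k] M) (f : M →ₗ[k] k) (g : M ⊗[k] M →ₗ[k] k) (t : M ⊗[k] M) :
    LinearMap.mul' k k (TensorProduct.map f g (D.lTensor M t)) =
    LinearMap.mul' k k (TensorProduct.map f (g ∘ₗ D) t) := by
  rw [LinearMap.lTensor, TensorProduct.map_map, LinearMap.comp_id]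

namespace ColouredQSym

variable (k : Type u) [Field k] {G : Type v} [LinearOrder G]

/-- The power series whose coefficient at a monomial is the value of `f` at its word. -/
def wordSeries : (GComposition G →₀ k) →ₗ[k] MvPowerSeries (ℕ × G) k where
  toFun f := fun e => f (monomialWord e)
  map_add' _ _ := rfl
  map_smul' _ _ := rfl

lemma coeff_wordSeries (f : GComposition G →₀ k) (e : ℕ × G →₀ ℕ) :
    MvPowerSeries.coeff e (wordSeries k f) = f (monomialWord e) := rfl

lemma wordSeries_injective : Function.Injective (wordSeries k (G := G)) := by
  intro f g h
  ext c
  have := congr_arg (MvPowerSeries.coeff (standardMonomial 0 c)) h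
  simpa [coeff_wordSeries, monomialWord_standardMonomial] using this

lemma wordSeries_single_nil (r : k) :
    wordSeries k (Finsupp.single ([] : GComposition G) r) = algebraMap k _ r := by
  classical
  ext e
  rw [coeff_wordSeries, MvPowerSeries.algebraMap_apply, MvPowerSeries.coeff_C,
    Finsupp.single_apply]
  exact if_congr ⟨fun h => eq_zero_of_monomialWord_eq_nil h.symm, fun h => by simp [h]⟩ rfl rfl

variable (G) [Finite G]

/-- The algebra `QSym(G)`. -/
def qsym : Subalgebra k (MvPowerSeries (ℕ × G) k) where
  carrier := Set.range (wordSeries k)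
  add_mem' := by
    rintro _ _ ⟨f, rfl⟩ ⟨g, rfl⟩
    exact ⟨f + g, map_add _ _ _⟩
  algebraMap_mem' r := ⟨_, wordSeries_single_nil k r⟩
  mul_mem' := by
    rintro _ _ ⟨f, rfl⟩ ⟨g, rfl⟩
    -- If a word of size greater than `N` is split in two, one of the pieces is too large for the
    -- support of `f` or of `g`.
    set N := f.support.sup size + g.support.sup size with hN
    have hfin : (Function.support fun c : GComposition G =>
        splitSum c fun a b => f a * g b).Finite := by
      refine (finite_size_le N).subset fun c hc => ?_
      by_contra hlt
      have hlt : N < size c := not_le.1 hlt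
      refine hc (splitSum_eq_zero c _ fun a b hab => ?_)
      by_contra h
      have ha := Finset.le_sup (f := size) (Finsupp.mem_support_iff.2 (left_ne_zero_of_mul h))
      have hb := Finset.le_sup (f := size) (Finsupp.mem_support_iff.2 (right_ne_zero_of_mul h))
      omega
    refine ⟨Finsupp.ofSupportFinite _ hfin, ?_⟩
    ext e
    rw [coeff_wordSeries, MvPowerSeries.coeff_mul]
    exact (sum_antidiagonal_monomialWord e fun a b => f a * g b).symm

/-- The basis of `QSym(G)` of the sums of all monomials with a given word. -/
def wordBasis : Module.Basis (GComposition G) k (qsym k G) :=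
  .ofRepr (LinearEquiv.ofBijective
    ((wordSeries k).codRestrict (qsym k G).toSubmodule fun f => ⟨f, rfl⟩)
    ⟨fun _ _ h => wordSeries_injective k (congr_arg Subtype.val h),
      fun ⟨_, f, hf⟩ => ⟨f, Subtype.ext hf⟩⟩).symm

variable {G}

/-- The coordinates with respect to `wordBasis`. -/
abbrev coord (c : GComposition G) : qsym k G →ₗ[k] k := (wordBasis k G).coord c

lemma coeff_eq_coord (q : qsym k G) (e : ℕ × G →₀ ℕ) :
    MvPowerSeries.coeff e (q : MvPowerSeries (ℕ × G) k) = coord k (monomialWord e) q := by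
  conv_lhs => rw [← (wordBasis k G).repr.symm_apply_apply q]
  rfl

lemma coord_eq_coeff (q : qsym k G) (c : GComposition G) :
    coord k c q = MvPowerSeries.coeff (standardMonomial 0 c) (q : MvPowerSeries (ℕ × G) k) := by
  rw [coeff_eq_coord, monomialWord_standardMonomial]

variable {k} in
lemma ext_coord {p q : qsym k G} (h : ∀ c, coord k c p = coord k c q) : p = q :=
  (wordBasis k G).repr.injective (Finsupp.ext h)

open Classical in
lemma coord_wordBasis (c d : GComposition G) :
    coord k c (wordBasis k G d) = if d = c then 1 else 0 := by
  simp [Finsupp.single_apply]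

lemma coord_mul (c : GComposition G) (p q : qsym k G) :
    coord k c (p * q) = splitSum c fun a b => coord k a p * coord k b q := by
  rw [coord_eq_coeff, MulMemClass.coe_mul, MvPowerSeries.coeff_mul]
  simp_rw [coeff_eq_coord]
  rw [sum_antidiagonal_monomialWord (standardMonomial 0 c) fun a b => coord k a p * coord k b q,
    monomialWord_standardMonomial]

lemma wordBasis_nil : wordBasis k G [] = 1 :=
  Subtype.ext ((wordSeries_single_nil k 1).trans (map_one _))

/-- The coordinates on the tensor square. -/
def coord₂ (c d : GComposition G) : qsym k G ⊗[k] qsym k G →ₗ[k] k :=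
  LinearMap.mul' k k ∘ₗ TensorProduct.map (coord k c) (coord k d)

@[simp] lemma coord₂_tmul (c d : GComposition G) (p q : qsym k G) :
    coord₂ k c d (p ⊗ₜ q) = coord k c p * coord k d q := rfl

variable {k} in
lemma ext_coord₂ {s t : qsym k G ⊗[k] qsym k G} (h : ∀ c d, coord₂ k c d s = coord₂ k c d t) :
    s = t := by
  refine ((wordBasis k G).tensorProduct (wordBasis k G)).repr.injective (Finsupp.ext ?_)
  rintro ⟨c, d⟩
  rw [Module.Basis.tensorProduct_repr_apply, Module.Basis.tensorProduct_repr_apply]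
  exact h c d

/-- The coordinates on the tensor cube. -/
def coord₃ (c d e : GComposition G) : qsym k G ⊗[k] (qsym k G ⊗[k] qsym k G) →ₗ[k] k :=
  LinearMap.mul' k k ∘ₗ TensorProduct.map (coord k c) (coord₂ k d e)

variable {k} in
lemma ext_coord₃ {s t : qsym k G ⊗[k] (qsym k G ⊗[k] qsym k G)}
    (h : ∀ c d e, coord₃ k c d e s = coord₃ k c d e t) : s = t :=
  (wordBasis k G).ext_tensor_cube h

lemma coord₂_mul (c d : GComposition G) (s t : qsym k G ⊗[k] qsym k G) :
    coord₂ k c d (s * t) = splitSum c fun a b => splitSum d fun a' b' =>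
      coord₂ k a a' s * coord₂ k b b' t := by
  induction s with
  | zero => simp [splitSum_eq_zero]
  | add x y hx hy =>
    rw [add_mul, map_add, hx, hy]
    simp only [map_add, add_mul, splitSum_add]
  | tmul p q =>
    induction t with
    | zero => simp [splitSum_eq_zero]
    | add x y hx hy =>
      rw [mul_add, map_add, hx, hy]
      simp only [map_add, mul_add, splitSum_add]
    | tmul p' q' =>
      rw [Algebra.TensorProduct.tmul_mul_tmul, coord₂_tmul, coord_mul, coord_mul, splitSum_mul]
      simp only [mul_splitSum, coord₂_tmul, mul_mul_mul_comm]

/-- Deconcatenation. -/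
def comulMap : qsym k G →ₗ[k] qsym k G ⊗[k] qsym k G :=
  (wordBasis k G).constr k fun c => ∑ i ∈ Finset.range (c.length + 1),
    wordBasis k G (c.take i) ⊗ₜ wordBasis k G (c.drop i)

lemma comulMap_wordBasis (c : GComposition G) :
    comulMap k (wordBasis k G c) = ∑ i ∈ Finset.range (c.length + 1),
      wordBasis k G (c.take i) ⊗ₜ wordBasis k G (c.drop i) := by
  rw [comulMap, Module.Basis.constr_basis]

/-- Deconcatenation is dual to concatenation: the only cut of a word that can produce `c` and `d` is
the one after `c.length` parts. -/
lemma coord₂_comulMap (c d : GComposition G) (q : qsym k G) :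
    coord₂ k c d (comulMap k q) = coord k (c ++ d) q := by
  classical
  suffices h : coord₂ k c d ∘ₗ comulMap k = coord k (c ++ d) from LinearMap.congr_fun h q
  refine (wordBasis k G).ext fun e => ?_
  rw [LinearMap.comp_apply, comulMap_wordBasis, map_sum, coord_wordBasis]
  simp only [coord₂_tmul, coord_wordBasis, mul_ite, mul_one, mul_zero, ← ite_and]
  split_ifs with h
  · subst h
    rw [Finset.sum_eq_single c.length]
    · simp
    · intro i hi hne
      refine if_neg fun h' => hne ?_
      have := congr_arg List.length h'.2
      simp at this hi
      omega
    · simp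
  · refine Finset.sum_eq_zero fun i _ => if_neg fun h' => h ?_
    rw [← h'.2, ← h'.1, List.take_append_drop]

/-- On coordinates, the axioms reduce to associativity of concatenation and neutrality of the empty
word. -/
instance : Coalgebra k (qsym k G) where
  comul := comulMap k
  counit := coord k []
  coassoc := by
    refine LinearMap.ext fun q => ext_coord₃ fun c d e => ?_
    have h₂ : ∀ c d : GComposition G, coord₂ k c d ∘ₗ comulMap k = coord k (c ++ d) :=
      fun c d => LinearMap.ext fun q => coord₂_comulMap k c d q
    have hl := TensorProduct.mul'_map_assoc_rTensor (comulMap k) (coord k c) (coord k d)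
      (coord k e) (comulMap k q)
    have hr := TensorProduct.mul'_map_lTensor (comulMap k) (coord k c) (coord₂ k d e)
      (comulMap k q)
    refine (hl.trans ?_).trans hr.symm
    rw [h₂]
    refine Eq.trans (congr_arg (fun f => LinearMap.mul' k k
      (TensorProduct.map f (coord k e) (comulMap k q))) (h₂ c d)) ?_
    refine (coord₂_comulMap k (c ++ d) e q).trans ?_
    rw [List.append_assoc]
    exact (coord₂_comulMap k c (d ++ e) q).symm
  rTensor_counit_comp_comul := by
    refine LinearMap.ext fun q => (TensorProduct.lid k _).injective (ext_coord fun c => ?_)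
    have h1 : ∀ t : qsym k G ⊗[k] qsym k G, coord k c
        (TensorProduct.lid k _ ((coord k []).rTensor _ t)) = coord₂ k [] c t := by
      intro t
      induction t with
      | zero => simp
      | add x y hx hy => simp only [map_add, hx, hy]
      | tmul x y => simp
    simp only [LinearMap.comp_apply]
    rw [h1, coord₂_comulMap]
    simp
  lTensor_counit_comp_comul := by
    refine LinearMap.ext fun q => (TensorProduct.rid k _).injective (ext_coord fun c => ?_)
    have h1 : ∀ t : qsym k G ⊗[k] qsym k G, coord k c
        (TensorProduct.rid k _ ((coord k []).lTensor _ t)) = coord₂ k c [] t := by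
      intro t
      induction t with
      | zero => simp
      | add x y hx hy => simp only [map_add, hx, hy]
      | tmul x y => simp [mul_comm]
    simp only [LinearMap.comp_apply]
    rw [h1, coord₂_comulMap]
    simp

lemma coord₂_comul (c d : GComposition G) (q : qsym k G) :
    coord₂ k c d (Coalgebra.comul (R := k) q) = coord k (c ++ d) q := coord₂_comulMap k c d q

lemma comul_wordBasis (c : GComposition G) :
    Coalgebra.comul (R := k) (wordBasis k G c) = ∑ i ∈ Finset.range (c.length + 1),
      wordBasis k G (c.take i) ⊗ₜ[k] wordBasis k G (c.drop i) := comulMap_wordBasis k c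

/-- Multiplicativity of the coproduct is dual to `splitSum_append`: splitting a concatenation means
splitting its factors. -/
instance : Bialgebra k (qsym k G) :=
  Bialgebra.mk' k (qsym k G)
    (by rw [← wordBasis_nil]; change coord k [] _ = 1; rw [coord_wordBasis, if_pos rfl])
    (coord_mul k [] _ _)
    (by
      rw [← wordBasis_nil]
      change comulMap k _ = _
      rw [comulMap_wordBasis]
      simp [wordBasis_nil, Algebra.TensorProduct.one_def])
    (by
      intro p q
      change comulMap k _ = comulMap k _ * comulMap k _
      refine ext_coord₂ fun c d => ?_
      rw [coord₂_mul, coord₂_comulMap, coord_mul, splitSum_append]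
      simp only [coord₂_comulMap])

/-! ### The antipode -/

/-- The values at the basis of the left inverse of the identity under convolution. -/
def leftAntipode : GComposition G → qsym k G
  | [] => 1
  | x :: c => -∑ i : Fin (c.length + 1),
      leftAntipode ((x :: c).take i) * wordBasis k G ((x :: c).drop i)
  termination_by c => c.length
  decreasing_by simp; omega

/-- The values at the basis of the right inverse of the identity under convolution. -/
def rightAntipode : GComposition G → qsym k G
  | [] => 1
  | x :: c => -∑ i : Fin (c.length + 1),
      wordBasis k G ((x :: c).take (i + 1)) * rightAntipode ((x :: c).drop (i + 1))
  termination_by c => c.length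
  decreasing_by simp

open WithConv

lemma leftAntipode_mul_id :
    toConv ((wordBasis k G).constr k (leftAntipode k)) * toConv LinearMap.id = 1 := by
  refine WithConv.ofConv_injective ((wordBasis k G).ext fun c => ?_)
  change LinearMap.mul' k _ (TensorProduct.map _ _ (Coalgebra.comul (R := k) _)) =
    algebraMap k _ (coord k [] _)
  rw [comul_wordBasis, coord_wordBasis]
  simp only [map_sum, TensorProduct.map_tmul, LinearMap.mul'_apply,
    Module.Basis.constr_basis, LinearMap.id_apply]
  obtain _ | ⟨x, c⟩ := c
  · simp [leftAntipode, wordBasis_nil]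
  -- The last cut contributes `leftAntipode` of the whole word times `1`; by the recursion it
  -- cancels all other terms.
  · rw [List.length_cons, Finset.sum_range_succ, Finset.sum_range, List.take_of_length_le (by simp),
      List.drop_of_length_le (by simp), wordBasis_nil, mul_one, leftAntipode]
    simp

lemma id_mul_rightAntipode :
    toConv LinearMap.id * toConv ((wordBasis k G).constr k (rightAntipode k)) = 1 := by
  refine WithConv.ofConv_injective ((wordBasis k G).ext fun c => ?_)
  change LinearMap.mul' k _ (TensorProduct.map _ _ (Coalgebra.comul (R := k) _)) =
    algebraMap k _ (coord k [] _)
  rw [comul_wordBasis, coord_wordBasis]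
  simp only [map_sum, TensorProduct.map_tmul, LinearMap.mul'_apply,
    Module.Basis.constr_basis, LinearMap.id_apply]
  obtain _ | ⟨x, c⟩ := c
  · simp [rightAntipode, wordBasis_nil]
  · rw [List.length_cons, Finset.sum_range_succ', Finset.sum_range, List.take_zero,
      List.drop_zero, wordBasis_nil, one_mul, rightAntipode]
    simp

instance : HopfAlgebra k (qsym k G) where
  antipode := (wordBasis k G).constr k (leftAntipode k)
  mul_antipode_rTensor_comul := congr_arg ofConv (leftAntipode_mul_id k (G := G))
  mul_antipode_lTensor_comul := by
    -- In the convolution monoid a left inverse and a right inverse coincide, so `leftAntipode`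
    -- serves on both sides.
    have h := left_inv_eq_right_inv (leftAntipode_mul_id k (G := G)) (id_mul_rightAntipode k)
    have h' := id_mul_rightAntipode k (G := G)
    rw [← h] at h'
    exact congr_arg ofConv h'

lemma antipode_wordBasis (c : GComposition G) :
    HopfAlgebra.antipode k (wordBasis k G c) = leftAntipode k c :=
  Module.Basis.constr_basis _ _ _ _

end ColouredQSym

-- For the empty word `consPart 0 g []` is again empty, which gives the value `1` at every `g`.
open Classical in
lemma zetaQ_apply (k : Type u) [Field k] {G : Type v} [DecidableEq G] (c : GComposition G) (g : G) :
    zetaQ k c g = if Refines (consPart (size c) g []) c then 1 else 0 := by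
  obtain _ | ⟨⟨m, h⟩, _ | ⟨y, c⟩⟩ := c
  · simp [zetaQ, Refines]
  · simp [zetaQ, Refines, Pi.single_apply]
  · rw [if_neg]
    · rfl
    · intro h'
      have := h'.length_le
      unfold consPart at this
      split at this <;> simp at this

namespace ColouredQSym

variable (k : Type u) [Field k] {G : Type v} [LinearOrder G] [Finite G]

/-! ### The grading -/

variable (G) in
/-- The homogeneous component of degree `n` of `QSym(G)`. -/
def grading (n : ℕ) : Submodule k (qsym k G) :=
  ⨅ c : {c : GComposition G // size c ≠ n}, LinearMap.ker (coord k c.1)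

lemma mem_grading {n : ℕ} {q : qsym k G} :
    q ∈ grading k G n ↔ ∀ c, size c ≠ n → coord k c q = 0 := by
  simp [grading]

lemma wordBasis_mem_grading (c : GComposition G) : wordBasis k G c ∈ grading k G (size c) :=
  (mem_grading k).2 fun d hd => by
    classical
    rw [coord_wordBasis, if_neg]
    rintro rfl
    exact hd rfl

lemma mem_of_wordBasis_mem {n : ℕ} {S : Submodule k (qsym k G)}
    (h : ∀ c, size c = n → wordBasis k G c ∈ S) {q : qsym k G} (hq : q ∈ grading k G n) :
    q ∈ S := by
  rw [← (wordBasis k G).linearCombination_repr q, Finsupp.linearCombination_apply]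
  refine Submodule.sum_mem _ fun c hc => S.smul_mem _ (h c ?_)
  by_contra hne
  exact Finsupp.mem_support_iff.1 hc ((mem_grading k).1 hq c hne)

lemma grading_eq_span (n : ℕ) :
    grading k G n = Submodule.span k {x | ∃ c, size c = n ∧ wordBasis k G c = x} := by
  refine le_antisymm (fun q hq => mem_of_wordBasis_mem k (fun c hc => ?_) hq)
    (Submodule.span_le.2 ?_)
  · exact Submodule.subset_span ⟨c, hc, rfl⟩
  rintro _ ⟨c, rfl, rfl⟩
  exact wordBasis_mem_grading k c

lemma isInternal_grading : DirectSum.IsInternal (grading k G) := by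
  refine DirectSum.isInternal_submodule_of_iSupIndep_of_iSup_eq_top ?_ ?_
  · rw [iSupIndep_def]
    intro n
    rw [Submodule.disjoint_def]
    intro q hq hq'
    refine ext_coord fun c => ?_
    rw [map_zero]
    by_cases hc : size c = n
    · have : ⨆ j, ⨆ (_ : j ≠ n), grading k G j ≤ LinearMap.ker (coord k c) :=
        iSup₂_le fun j hj p hp => (mem_grading k).1 hp c fun h => hj (h.symm.trans hc)
      exact this hq'
    · exact (mem_grading k).1 hq c hc
  · rw [eq_top_iff, ← (wordBasis k G).span_eq, Submodule.span_le]
    rintro _ ⟨c, rfl⟩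
    exact Submodule.mem_iSup_of_mem _ (wordBasis_mem_grading k c)

instance : SetLike.GradedMonoid (grading k G) where
  one_mem := wordBasis_nil k (G := G) ▸ wordBasis_mem_grading k []
  mul_mem m n p q hp hq := by
    rw [mem_grading] at hp hq ⊢
    intro c hc
    rw [coord_mul]
    refine splitSum_eq_zero c _ fun a b hab => ?_
    by_cases ha : size a = m
    · rw [hq b (by omega), mul_zero]
    · rw [hp a ha, zero_mul]

lemma comul_mem_grading (n : ℕ) (q : qsym k G) (hq : q ∈ grading k G n) :
    Coalgebra.comul (R := k) q ∈ ⨆ p ∈ antidiagonal n,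
      LinearMap.range (TensorProduct.map (grading k G p.1).subtype (grading k G p.2).subtype) := by
  refine mem_of_wordBasis_mem k (S := Submodule.comap (Coalgebra.comul (R := k)) (⨆ p ∈
    antidiagonal n, LinearMap.range (TensorProduct.map (grading k G p.1).subtype
      (grading k G p.2).subtype))) (fun c hc => ?_) hq
  rw [Submodule.mem_comap, comul_wordBasis]
  refine Submodule.sum_mem _ fun i _ => ?_
  have hi : (size (c.take i), size (c.drop i)) ∈ antidiagonal n := by
    rw [Finset.HasAntidiagonal.mem_antidiagonal, ← size_append, List.take_append_drop, hc]
  refine Submodule.mem_iSup_of_mem _ (Submodule.mem_iSup_of_mem hi ?_)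
  exact ⟨⟨_, wordBasis_mem_grading k _⟩ ⊗ₜ ⟨_, wordBasis_mem_grading k _⟩, rfl⟩

lemma leftAntipode_mem_grading (c : GComposition G) :
    leftAntipode k c ∈ grading k G (size c) := by
  induction hn : c.length using Nat.strong_induction_on generalizing c with
  | _ n ih =>
    obtain _ | ⟨x, c⟩ := c
    · rw [leftAntipode]
      exact SetLike.GradedOne.one_mem
    · rw [leftAntipode]
      refine Submodule.neg_mem _ (Submodule.sum_mem _ fun i _ => ?_)
      have hs : size (x :: c) = size ((x :: c).take i) + size ((x :: c).drop i) := by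
        rw [← size_append, List.take_append_drop]
      rw [hs]
      refine SetLike.GradedMul.mul_mem (ih _ ?_ _ rfl) (wordBasis_mem_grading k _)
      rw [← hn, List.length_take, List.length_cons]
      omega

lemma antipode_mem_grading (n : ℕ) (q : qsym k G) (hq : q ∈ grading k G n) :
    HopfAlgebra.antipode k q ∈ grading k G n :=
  mem_of_wordBasis_mem k (S := Submodule.comap (HopfAlgebra.antipode k) (grading k G n))
    (fun c hc => by
      rw [Submodule.mem_comap, antipode_wordBasis, ← hc]
      exact leftAntipode_mem_grading k c) hq

lemma grading_zero : grading k G 0 = Submodule.span k {1} := by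
  rw [grading_eq_span, ← wordBasis_nil]
  congr 1
  ext x
  simp [size_eq_zero_iff, eq_comm]

/-! ### The fundamental basis -/

/-- The element of `QSym(G)` with the underlying series `fundamentalF k c`. -/
def fundamental (c : GComposition G) : qsym k G :=
  ∑ d ∈ (finite_refines c).toFinset, wordBasis k G d

open Classical in
lemma coord_fundamental (c d : GComposition G) :
    coord k d (fundamental k c) = if Refines d c then 1 else 0 := by
  rw [fundamental, map_sum]
  simp only [coord_wordBasis]
  simp

lemma coe_fundamental (c : GComposition G) :
    (fundamental k c : MvPowerSeries (ℕ × G) k) = fundamentalF k c := by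
  classical
  ext e
  rw [coeff_eq_coord, coord_fundamental]
  exact (fundamentalF_apply k c e).symm

lemma fundamental_mem_grading (c : GComposition G) :
    fundamental k c ∈ grading k G (size c) :=
  Submodule.sum_mem _ fun d hd => by
    have hd : Refines d c := by simpa using hd
    exact hd.size_eq ▸ wordBasis_mem_grading k d

/-- Unitriangularity: `F_c` is `M_c` plus the `M_d` for proper refinements `d`, which have more
parts. -/
lemma wordBasis_mem_span_fundamental (n : ℕ) (c : GComposition G) (hc : size c = n) :
    wordBasis k G c ∈ Submodule.span k {x | ∃ c, size c = n ∧ fundamental k c = x} := by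
  classical
  -- The number of parts increases along proper refinements and is bounded by the size `n`.
  induction hl : n - c.length using Nat.strong_induction_on generalizing c with
  | _ l ih =>
    have hself : c ∈ (finite_refines c).toFinset := by simpa using Refines.refl c
    have hF : fundamental k c = wordBasis k G c +
        ∑ d ∈ (finite_refines c).toFinset.erase c, wordBasis k G d :=
      (Finset.add_sum_erase _ _ hself).symm
    rw [eq_sub_of_add_eq hF.symm]
    refine Submodule.sub_mem _ (Submodule.subset_span ⟨c, hc, rfl⟩)
      (Submodule.sum_mem _ fun d hd => ?_)
    obtain ⟨hne, hd⟩ : d ≠ c ∧ Refines d c := by simpa using hd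
    have hlt : c.length < d.length := by
      by_contra h
      exact hne (hd.eq_of_length_le (not_lt.1 h))
    have hdn : size d = n := hd.size_eq.trans hc
    have := length_le_size d
    exact ih _ (by omega) d hdn rfl

lemma grading_eq_span_fundamental (n : ℕ) :
    grading k G n = Submodule.span k {x | ∃ c, size c = n ∧ fundamental k c = x} := by
  refine le_antisymm (fun q => mem_of_wordBasis_mem k (wordBasis_mem_span_fundamental k n))
    (Submodule.span_le.2 ?_)
  rintro _ ⟨c, rfl, rfl⟩
  exact fundamental_mem_grading k c

lemma span_fundamental : Submodule.span k (Set.range (fundamental k (G := G))) = ⊤ := by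
  rw [eq_top_iff, ← (wordBasis k G).span_eq, Submodule.span_le]
  rintro _ ⟨c, rfl⟩
  refine Submodule.span_mono ?_ (wordBasis_mem_span_fundamental k _ c rfl)
  rintro _ ⟨d, -, rfl⟩
  exact ⟨d, rfl⟩

lemma range_val_qsym : LinearMap.range (qsym k G).val.toLinearMap = QSymG k G := by
  rw [LinearMap.range_eq_map, ← span_fundamental, Submodule.map_span, QSymG, ← Set.range_comp]
  congr 2
  funext c
  exact coe_fundamental k c

/-- At the coordinates `a` and `b` only the cut `i = size a` can contribute, and `refines_append`
evaluates that term. -/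
lemma comul_fundamental (c : GComposition G) :
    Coalgebra.comul (R := k) (fundamental k c) = ∑ i ∈ Finset.range (size c + 1),
      fundamental k (c.initialPart i) ⊗ₜ[k] fundamental k (c.finalPart i) := by
  classical
  refine ext_coord₂ fun a b => ?_
  rw [coord₂_comul, map_sum, coord_fundamental]
  simp only [coord₂_tmul, coord_fundamental, mul_ite, mul_one, mul_zero, ← ite_and]
  split_ifs with h
  · have hs := h.size_eq
    rw [size_append] at hs
    rw [refines_append] at h
    rw [Finset.sum_eq_single (size a), if_pos h.symm]
    · intro i hi hne
      refine if_neg fun h' => hne ?_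
      rw [h'.2.size_eq, size_initialPart]
      exact Nat.lt_succ_iff.1 (Finset.mem_range.1 hi)
    · intro h'
      exact (h' (Finset.mem_range.2 (by omega))).elim
  · refine (Finset.sum_eq_zero fun i hi => if_neg fun h' => h (refines_append.2 ?_)).symm
    have : size a = i := by
      rw [h'.2.size_eq, size_initialPart]
      exact Nat.lt_succ_iff.1 (Finset.mem_range.1 hi)
    rw [this]
    exact h'.symm

/-! ### The character -/

/-- The linear map `ζ_Q^G`. -/
def zetaLinear : qsym k G →ₗ[k] (G → k) := (wordBasis k G).constr k (zetaQ k)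

/-- Makes the character a coordinate in each degree. Multiplicativity of `ζ_Q` and both halves of
the universal property rest on this. -/
lemma zetaLinear_of_mem {n : ℕ} {q : qsym k G} (hq : q ∈ grading k G n) (g : G) :
    zetaLinear k q g = coord k (consPart n g []) q := by
  classical
  have : q ∈ LinearMap.ker (LinearMap.proj g ∘ₗ zetaLinear k - coord k (consPart n g [])) := by
    refine mem_of_wordBasis_mem k (fun c hc => ?_) hq
    subst hc
    rw [LinearMap.mem_ker, LinearMap.sub_apply, LinearMap.comp_apply, zetaLinear,
      Module.Basis.constr_basis, LinearMap.proj_apply, zetaQ_apply, coord_wordBasis, sub_eq_zero]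
    exact if_congr (refines_consPart_nil_iff c g) rfl rfl
  exact sub_eq_zero.1 this

lemma zetaLinear_fundamental (c : GComposition G) : zetaLinear k (fundamental k c) = zetaQ k c := by
  classical
  ext g
  rw [zetaLinear_of_mem k (fundamental_mem_grading k c), coord_fundamental, zetaQ_apply]

/-- A one-part word splits only into words with at most one part, all of colour `g`; for basis
elements, degree leaves the single splitting `(size c, size d)`. -/
lemma zetaLinear_mul (p q : qsym k G) :
    zetaLinear k (p * q) = zetaLinear k p * zetaLinear k q := by
  suffices h : (LinearMap.mul k (qsym k G)).compr₂ (zetaLinear k) =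
      (LinearMap.mul k (G → k)).compl₁₂ (zetaLinear k) (zetaLinear k) from
    LinearMap.congr_fun (LinearMap.congr_fun h p) q
  refine (wordBasis k G).ext fun c => (wordBasis k G).ext fun d => ?_
  change zetaLinear k (wordBasis k G c * wordBasis k G d) =
    zetaLinear k (wordBasis k G c) * zetaLinear k (wordBasis k G d)
  have hc := wordBasis_mem_grading k c
  have hd := wordBasis_mem_grading k d
  ext g
  rw [Pi.mul_apply, zetaLinear_of_mem k (SetLike.GradedMul.mul_mem hc hd), zetaLinear_of_mem k hc,
    zetaLinear_of_mem k hd, coord_mul, splitSum_consPart]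
  simp only [splitSum_nil]
  refine Finset.sum_eq_single (size c, size d) (fun p hp hne => ?_) (fun h => ?_)
  · by_cases h : p.1 = size c
    · have hp : p.1 + p.2 = size c + size d := by simpa using hp
      have h2 : p.2 ≠ size d := fun h2 => hne (Prod.ext h h2)
      rw [(mem_grading k).1 hd _ (by simpa using h2), mul_zero]
    · rw [(mem_grading k).1 hc _ (by simpa using h), zero_mul]
  · simp at h

/-- The character `ζ_Q^G`. -/
def zetaHom : qsym k G →ₐ[k] (G → k) :=
  AlgHom.ofLinearMap (zetaLinear k)
    (by rw [← wordBasis_nil, zetaLinear, Module.Basis.constr_basis]; rfl) (zetaLinear_mul k)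

variable (G) in
/-- The combinatorial `G`-coloured Hopf algebra `(QSym(G), ζ_Q^G)`. -/
def colouredHopf : ColouredHopf.{u, v, max u v} k G where
  carrier := qsym k G
  grading := grading k G
  internal := isInternal_grading k
  gradedMonoid := inferInstance
  comul_mem := comul_mem_grading k
  counit_eq_zero := fun _ hn _ hx => (mem_grading k).1 hx [] hn.symm
  antipode_mem := antipode_mem_grading k
  connected := grading_zero k
  character := zetaHom k

lemma isQSymG_colouredHopf : (colouredHopf k G).IsQSymG (qsym k G).val :=
  ⟨Subtype.val_injective, range_val_qsym k, fundamental k, coe_fundamental k,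
    grading_eq_span_fundamental k, comul_fundamental k, zetaLinear_fundamental k⟩

end ColouredQSym

open WithConv

/-! ### The characters of a combinatorial coloured Hopf algebra -/

namespace ColouredHopf

variable {k : Type u} [Field k] {G : Type v} (X : ColouredHopf.{u, v, w} k G)

/-- The projection onto a homogeneous component. -/
def proj (n : ℕ) : X.carrier →ₗ[k] X.carrier :=
  (X.grading n).subtype ∘ₗ DirectSum.component k ℕ (fun i => X.grading i) n ∘ₗ
    (LinearEquiv.ofBijective (DirectSum.coeLinearMap X.grading) X.internal).symm.toLinearMap

variable {X} in
lemma proj_of_mem {m n : ℕ} {x : X.carrier} (hx : x ∈ X.grading n) :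
    X.proj m x = if m = n then x else 0 := by
  have h : (LinearEquiv.ofBijective (DirectSum.coeLinearMap X.grading) X.internal).symm x =
      DirectSum.lof k ℕ (fun i => X.grading i) n ⟨x, hx⟩ := by
    rw [LinearEquiv.symm_apply_eq]
    exact (DirectSum.coeLinearMap_lof X.grading n ⟨x, hx⟩).symm
  simp only [proj, LinearMap.comp_apply, LinearEquiv.coe_coe]
  rw [h]
  split_ifs with hmn
  · subst hmn
    rw [DirectSum.component.lof_self]
    rfl
  · rw [DirectSum.component.of, dif_neg (Ne.symm hmn), map_zero]

variable {X} in
lemma ext_grading {M : Type*} [AddCommGroup M] [Module k M] {f g : X.carrier →ₗ[k] M}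
    (h : ∀ n, ∀ x ∈ X.grading n, f x = g x) : f = g := by
  have : (⨆ n, X.grading n) ≤ LinearMap.eqLocus f g := iSup_le fun n x hx => h n x hx
  rw [X.internal.submodule_iSup_eq_top] at this
  exact LinearMap.ext fun x => this trivial

/-- The component in degree `m` of the coordinate of the character at `g`. -/
def partChar (m : ℕ) (g : G) : X.carrier →ₗ[k] k :=
  LinearMap.proj g ∘ₗ X.character.toLinearMap ∘ₗ X.proj m

variable {X} in
lemma partChar_of_mem {m n : ℕ} (g : G) {x : X.carrier} (hx : x ∈ X.grading n) :
    X.partChar m g x = if m = n then X.character x g else 0 := by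
  rw [partChar, LinearMap.comp_apply, LinearMap.comp_apply, proj_of_mem hx]
  split_ifs <;> simp

/-- Connectedness enters here: degree `0` consists of scalars, on which the character and the counit
are both determined by their value at `1`. -/
lemma partChar_zero (g : G) : X.partChar 0 g = Coalgebra.counit := by
  refine ext_grading fun n x hx => ?_
  rw [partChar_of_mem g hx]
  split_ifs with h
  · subst h
    rw [X.connected] at hx
    obtain ⟨r, rfl⟩ := Submodule.mem_span_singleton.1 hx
    simp
  · exact (X.counit_eq_zero n (Ne.symm h) x hx).symm

lemma partChar_mul (m : ℕ) (g : G) (x y : X.carrier) :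
    X.partChar m g (x * y) =
      ∑ p ∈ antidiagonal m, X.partChar p.1 g x * X.partChar p.2 g y := by
  suffices h : (LinearMap.mul k X.carrier).compr₂ (X.partChar m g) =
      ∑ p ∈ antidiagonal m,
        (LinearMap.mul k k).compl₁₂ (X.partChar p.1 g) (X.partChar p.2 g) by
    have := LinearMap.congr_fun (LinearMap.congr_fun h x) y
    simpa [LinearMap.sum_apply] using this
  refine ext_grading fun i x hx => ext_grading fun j y hy => ?_
  simp only [LinearMap.compr₂_apply, LinearMap.mul_apply', LinearMap.sum_apply,
    LinearMap.compl₁₂_apply]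
  rw [partChar_of_mem g (X.gradedMonoid.mul_mem hx hy)]
  simp only [partChar_of_mem g hx, partChar_of_mem g hy]
  split_ifs with h
  · rw [Finset.sum_eq_single (i, j)]
    · simp
    · intro p hp hne
      by_cases h1 : p.1 = i
      · rw [if_neg fun h2 : p.2 = j => hne (Prod.ext h1 h2), mul_zero]
      · rw [if_neg h1, zero_mul]
    · intro h'
      exact (h' (Finset.HasAntidiagonal.mem_antidiagonal.2 h.symm)).elim
  · refine (Finset.sum_eq_zero fun p hp => ?_).symm
    have hp : p.1 + p.2 = m := by simpa using hp
    by_cases h1 : p.1 = i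
    · rw [if_neg fun h2 : p.2 = j => h (by rw [← hp, h1, h2]), mul_zero]
    · rw [if_neg h1, zero_mul]

/-- The convolution product of the functionals `partChar m g`, for the parts `m^g` of a word. -/
def wordChar (c : GComposition G) : WithConv (X.carrier →ₗ[k] k) :=
  (c.map fun p => toConv (X.partChar p.1 p.2)).prod

lemma wordChar_nil : X.wordChar [] = 1 := rfl

lemma wordChar_append (c d : GComposition G) :
    X.wordChar (c ++ d) = X.wordChar c * X.wordChar d := by
  simp [wordChar]

lemma wordChar_consPart (m : ℕ) (g : G) (c : GComposition G) :
    X.wordChar (consPart m g c) = toConv (X.partChar m g) * X.wordChar c := by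
  unfold consPart
  split_ifs with h
  · rfl
  · have : m = 0 := by omega
    subst this
    rw [partChar_zero]
    exact (one_mul _).symm

variable {X} in
lemma wordChar_of_mem {n : ℕ} {x : X.carrier} (hx : x ∈ X.grading n) {c : GComposition G}
    (hc : size c ≠ n) : X.wordChar c x = 0 := by
  induction c generalizing n x with
  | nil => exact X.counit_eq_zero n (Ne.symm hc) x hx
  | cons y c ih =>
    have hle : (⨆ p ∈ antidiagonal n, LinearMap.range (TensorProduct.map
        (X.grading p.1).subtype (X.grading p.2).subtype)) ≤
        LinearMap.ker (LinearMap.mul' k k ∘ₗ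
          TensorProduct.map (X.partChar y.1 y.2) (X.wordChar c).ofConv) := by
      refine iSup₂_le fun p hp => ?_
      rintro _ ⟨t, rfl⟩
      have hp : p.1 + p.2 = n := by simpa using hp
      rw [LinearMap.mem_ker, LinearMap.comp_apply, TensorProduct.map_map]
      by_cases h1 : (y.1 : ℕ) = p.1
      · have h2 : (X.wordChar c).ofConv ∘ₗ (X.grading p.2).subtype = 0 :=
          LinearMap.ext fun z => ih z.2 fun h => hc (by rw [size_cons, h1, h, hp])
        rw [h2, TensorProduct.map_zero_right, LinearMap.zero_apply, map_zero]
      · have h2 : X.partChar y.1 y.2 ∘ₗ (X.grading p.1).subtype = 0 :=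
          LinearMap.ext fun z => (partChar_of_mem y.2 z.2).trans (if_neg h1)
        rw [h2, TensorProduct.map_zero_left, LinearMap.zero_apply, map_zero]
    exact hle (X.comul_mem n x hx)

lemma wordChar_one [DecidableEq G] (c : GComposition G) :
    X.wordChar c 1 = if c = [] then 1 else 0 := by
  split_ifs with h
  · subst h
    exact Bialgebra.counit_one
  · exact wordChar_of_mem X.gradedMonoid.one_mem fun h' => h (size_eq_zero_iff.1 h')

/-- The splitting rule of `coord_mul`, now in `X`. Each factor splits by `partChar_mul`, and the
coproduct of `X` is multiplicative; terms with a zero part are absorbed since `partChar 0` is the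
convolution unit. -/
lemma wordChar_mul (c : GComposition G) (x y : X.carrier) :
    X.wordChar c (x * y) = splitSum c fun a b => X.wordChar a x * X.wordChar b y := by
  induction c generalizing x y with
  | nil => exact Bialgebra.counit_mul x y
  | cons p c ih =>
    obtain ⟨m, g⟩ := p
    -- Arbitrary tensors replace the coproducts of `x` and `y`, so that bilinearity reduces the
    -- claim to pure tensors.
    have key : ∀ s t : X.carrier ⊗[k] X.carrier,
        LinearMap.mul' k k (TensorProduct.map (X.partChar m g) (X.wordChar c).ofConv (s * t)) =
        ∑ p ∈ antidiagonal (m : ℕ), splitSum c fun a b =>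
          LinearMap.mul' k k (TensorProduct.map (X.partChar p.1 g) (X.wordChar a).ofConv s) *
          LinearMap.mul' k k (TensorProduct.map (X.partChar p.2 g) (X.wordChar b).ofConv t) := by
      intro s t
      induction s with
      | zero => simp [splitSum_eq_zero]
      | add x y hx hy =>
        simp only [add_mul, map_add, hx, hy, splitSum_add, Finset.sum_add_distrib]
      | tmul x x' =>
        induction t with
        | zero => simp [splitSum_eq_zero]
        | add x y hx hy =>
          simp only [mul_add, map_add, hx, hy, splitSum_add, Finset.sum_add_distrib]
        | tmul y y' =>
          rw [Algebra.TensorProduct.tmul_mul_tmul, TensorProduct.map_tmul, LinearMap.mul'_apply,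
            partChar_mul, Finset.sum_mul]
          refine Finset.sum_congr rfl fun p _ => ?_
          refine (congr_arg _ (ih x' y')).trans ?_
          rw [mul_splitSum]
          exact congr_arg (splitSum c) (funext fun a => funext fun b => mul_mul_mul_comm _ _ _ _)
    refine (congr_arg (fun t => LinearMap.mul' k k (TensorProduct.map (X.partChar m g)
      (X.wordChar c).ofConv t)) (Bialgebra.comul_mul x y)).trans ((key _ _).trans ?_)
    simp only [splitSum, wordChar_consPart]
    rfl

lemma finite_support_wordChar [Finite G] (x : X.carrier) :
    (Function.support fun c => X.wordChar c x).Finite := by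
  have hx : x ∈ ⨆ n, X.grading n := by
    rw [X.internal.submodule_iSup_eq_top]
    trivial
  induction hx using Submodule.iSup_induction' with
  | mem n x hx =>
    refine (finite_size_le n).subset fun c hc => ?_
    by_contra h
    exact hc (wordChar_of_mem hx fun h' => h h'.le)
  | zero => exact Set.finite_empty.subset fun c hc => hc (map_zero (X.wordChar c).ofConv)
  | add x y _ _ hx hy =>
    refine (hx.union hy).subset fun c hc => ?_
    by_contra h
    simp only [Set.mem_union, Function.mem_support, not_or, not_not] at h
    refine hc ((map_add (X.wordChar c).ofConv x y).trans ?_)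
    exact (congr_arg₂ (· + ·) h.1 h.2).trans (add_zero 0)

end ColouredHopf

/-! ### The universal property -/

namespace ColouredQSym

variable {k : Type u} [Field k] {G : Type v} [LinearOrder G] [Finite G]
  (X : ColouredHopf.{u, v, w} k G)

/-- The linear map with the coordinates `wordChar c`. -/
def liftLinear : X.carrier →ₗ[k] qsym k G :=
  (wordBasis k G).repr.symm.toLinearMap ∘ₗ
    { toFun := fun x => Finsupp.ofSupportFinite _ (X.finite_support_wordChar x)
      map_add' := fun x y => Finsupp.ext fun c => map_add (X.wordChar c).ofConv x y
      map_smul' := fun r x => Finsupp.ext fun c => map_smul (X.wordChar c).ofConv r x }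

lemma coord_liftLinear (c : GComposition G) (x : X.carrier) :
    coord k c (liftLinear X x) = X.wordChar c x := by
  simp [liftLinear]
  rfl

/-- The algebra morphism with the coordinates `wordChar c`. -/
def liftAlgHom : X.carrier →ₐ[k] qsym k G :=
  AlgHom.ofLinearMap (liftLinear X)
    (ext_coord fun c => by
      rw [coord_liftLinear, X.wordChar_one, ← wordBasis_nil, coord_wordBasis]
      exact if_congr eq_comm rfl rfl)
    (fun x y => ext_coord fun c => by
      rw [coord_liftLinear, X.wordChar_mul, coord_mul]
      simp only [coord_liftLinear])

lemma coord₂_map {A B : Type*} [AddCommGroup A] [Module k A] [AddCommGroup B] [Module k B]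
    (f : A →ₗ[k] qsym k G) (g : B →ₗ[k] qsym k G) (c d : GComposition G) (t : A ⊗[k] B) :
    coord₂ k c d (TensorProduct.map f g t) =
      LinearMap.mul' k k (TensorProduct.map (coord k c ∘ₗ f) (coord k d ∘ₗ g) t) := by
  rw [coord₂, LinearMap.comp_apply, TensorProduct.map_map]

/-- The bialgebra morphism with the coordinates `wordChar c`. -/
def liftBialgHom : X.carrier →ₐc[k] qsym k G :=
  BialgHom.ofAlgHom (liftAlgHom X)
    (AlgHom.ext fun x => coord_liftLinear X [] x)
    (AlgHom.ext fun x => ext_coord₂ fun c d => by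
      have h : ∀ c, coord k c ∘ₗ liftLinear X = (X.wordChar c).ofConv :=
        fun c => LinearMap.ext fun x => coord_liftLinear X c x
      refine (coord₂_map (liftLinear X) (liftLinear X) c d _).trans ?_
      rw [h, h]
      refine Eq.trans ?_ (coord₂_comul k c d (liftLinear X x)).symm
      rw [coord_liftLinear, X.wordChar_append]
      rfl)

/-- The morphism to `(QSym(G), ζ_Q^G)`. -/
def lift : ColouredHopf.Hom X (colouredHopf k G) where
  toBialgHom := liftBialgHom X
  graded n x hx := (mem_grading k).2 fun c hc =>
    (coord_liftLinear X c x).trans (ColouredHopf.wordChar_of_mem hx hc)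
  comm := by
    suffices h : zetaLinear k ∘ₗ liftLinear X = X.character.toLinearMap from
      fun x => LinearMap.congr_fun h x
    refine ColouredHopf.ext_grading fun n x hx => funext fun g => ?_
    have hmem : liftLinear X x ∈ grading k G n := (mem_grading k).2 fun c hc =>
      (coord_liftLinear X c x).trans (ColouredHopf.wordChar_of_mem hx hc)
    rw [LinearMap.comp_apply, zetaLinear_of_mem k hmem, coord_liftLinear, X.wordChar_consPart,
      X.wordChar_nil, mul_one]
    exact (ColouredHopf.partChar_of_mem g hx).trans (if_pos rfl)

-- Uniqueness: the counit fixes the coordinate at the empty word, the grading and the character fix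
-- those at one-part words, and the coproduct, dual to concatenation, fixes the others.
variable {X} in
lemma coord_hom_apply (f : ColouredHopf.Hom X (colouredHopf k G)) (c : GComposition G)
    (x : X.carrier) : coord k c (f.toBialgHom x) = X.wordChar c x := by
  let F : X.carrier →ₐc[k] qsym k G := f.toBialgHom
  let F' : X.carrier →ₗ[k] qsym k G := F.toCoalgHom.toLinearMap
  change coord k c (F' x) = _
  induction c generalizing x with
  | nil => exact CoalgHomClass.counit_comp_apply F x
  | cons p c ih =>
    obtain ⟨m, g⟩ := p
    -- In degree `m` the left side is the `g`-coordinate of `ζ_Q`, which the morphism preserves; in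
    -- other degrees both sides vanish because the morphism is graded.
    have h1 : coord k [(m, g)] ∘ₗ F' = X.partChar m g := by
      refine ColouredHopf.ext_grading fun n y hy => ?_
      have hmem : F' y ∈ grading k G n := f.graded n y hy
      rw [ColouredHopf.partChar_of_mem g hy, LinearMap.comp_apply]
      split_ifs with h
      · subst h
        have h2 := zetaLinear_of_mem k hmem g
        rw [consPart_coe] at h2
        rw [← h2]
        exact congr_fun (f.comm y) g
      · exact (mem_grading k).1 hmem _ (by simpa using h)
    have h2 : coord k c ∘ₗ F' = (X.wordChar c).ofConv := LinearMap.ext fun y => ih y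
    have h3 : Coalgebra.comul (R := k) (F' x) =
        TensorProduct.map F' F' (Coalgebra.comul (R := k) x) :=
      (CoalgHomClass.map_comp_comul_apply F x).symm
    rw [← List.singleton_append, ← coord₂_comul, h3, coord₂_map, h1, h2]
    rfl

theorem hom_eq_lift (f : ColouredHopf.Hom X (colouredHopf k G)) : f = lift X :=
  ColouredHopf.Hom.ext (BialgHom.ext fun x => ext_coord fun c =>
    (coord_hom_apply f c x).trans (coord_hom_apply (lift X) c x).symm)

/-- The uniqueness of the morphism to `(QSym(G), ζ_Q^G)`. -/
instance uniqueHom : Unique (ColouredHopf.Hom X (colouredHopf k G)) where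
  default := lift X
  uniq := hom_eq_lift X

end ColouredQSym

end

/-- Terminality in the category concerns Hopf algebras in the universe of `Q`; the last clause gives
the same universal property for `X` in an arbitrary universe. -/
theorem mainTheorem6 (k : Type u) [Field k] (G : Type v) [CommGroup G] [Finite G]
    [LinearOrder G] :
    ∃ (Q : ColouredHopf.{u, v, max u v} k G) (ι : Q.carrier →ₐ[k] MvPowerSeries (ℕ × G) k),
      Q.IsQSymG ι ∧
      Nonempty (CategoryTheory.Limits.IsTerminal Q) ∧
      ∀ X : ColouredHopf.{u, v, w} k G, Nonempty (Unique (ColouredHopf.Hom X Q)) :=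
  ⟨ColouredQSym.colouredHopf k G, (ColouredQSym.qsym k G).val,
    ColouredQSym.isQSymG_colouredHopf k,
    ⟨CategoryTheory.Limits.IsTerminal.ofUniqueHom (fun X => ColouredQSym.lift X)
      fun X f => ColouredQSym.hom_eq_lift X f⟩,
    fun X => ⟨ColouredQSym.uniqueHom X⟩⟩
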